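/- Let $\omega=(\omega_x)_{x\in\mathbb Z}\in[0,1]^{\mathbb Z}$ be i.i.d. with law $\alpha$, and let $\rho_x=(1-\omega_x)/\omega_x\in[0,\infty]$ and $\Pi_{i,j}=\prod_{k=i}^{j}\rho_k$. For a fixed environment $\omega$, let $P_\omega^x$ (with expectation $E_\omega^x$) be the law of the nearest-neighbour Markov chain $(X_n)_{n\ge0}$ on $\mathbb Z$ with $X_0=x$ that jumps from $y$ to $y+1$ with probability $\omega_y$ and to $y-1$ with probability $1-\omega_y$, and let $T_y=\inf\{n\ge 0: X_n=y\}$. Assume that, for some $s>1$, $$E_\alpha[\log\rho_0]<0,\qquad E_\alpha[\rho_0^s]=1,\qquad E_\alpha[\rho_0^s\log\rho_0]<\infty,$$ and that $\log\rho_0$ is non-lattice (there is no $h>0$ such that $\log\rho_0\in h\mathbb Z$ almost surely). Define the ladder points $(\nu_i)_{i\in\mathbb Z}$ of $\omega$ by $\nu_0=\sup\{y\le 0:\Pi_{k,y-1}<1\ \forall k<y\}$ and, for $i\ge1$, $\nu_i=\inf\{x>\nu_{i-1}:\Pi_{\nu_{i-1},x-1}<1\}$ and $\nu_{-i}=\sup\{y<\nu_{-i+1}:\Pi_{k,y-1}<1\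 \forall k<y\}$. Let $$M_i=\max\{\Pi_{\nu_i,j}:\nu_i\le j<\nu_{i+1}\},\qquad \beta_i=E_\omega^{\nu_i}[T_{\nu_{i+1}}],\qquad Q(\cdot)=\alpha(\,\cdot\mid\nu_0=0).$$ Then $\alpha(\nu_0=0)>0$ and $E_Q[\beta_0]<\infty$. Moreover, let $\eta_1>\eta_2>0$, $a_n=n^{\eta_1}$ and $b_n=n^{\eta_2}$. Then for every $\varepsilon>0$ there are constants $C,C'>0$ such that, for all integers $n\ge1$, $$Q\Bigl(\sum_{0\le i<a_n}\bigl(\beta_i\mathbf 1_{\{M_i\le b_n\}}-E_Q[\beta_0]\bigr)>\varepsilon a_n\Bigr)\le C'a_n e^{-C(\log n)^2}.$$ -/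

import Mathlib

open MeasureTheory ProbabilityTheory
open scoped ENNReal

noncomputable section

namespace RWRE

/-- An environment `ω = (ω_x)_{x ∈ ℤ}`, an element of `[0,1]^ℤ`. -/
abbrev Env : Type := ℤ → Set.Icc (0 : ℝ) 1

/-- `(1 - p) / p` in `[0, ∞]` (equal to `∞` exactly when `p = 0`, to `0` exactly when `p = 1`). -/
def odds (p : Set.Icc (0 : ℝ) 1) : ℝ≥0∞ :=
  ENNReal.ofReal (1 - (p : ℝ)) / ENNReal.ofReal (p : ℝ)

/-- `ρ_x = (1 - ω_x) / ω_x`. -/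
def rho (ω : Env) (x : ℤ) : ℝ≥0∞ := odds (ω x)

/-- `Π_{i,j} = ∏_{k = i}^{j} ρ_k`. -/
def rhoProd (ω : Env) (i j : ℤ) : ℝ≥0∞ := ∏ k ∈ Finset.Icc i j, rho ω k

/-- The law `α` of an i.i.d. environment whose coordinates have law `μ`. -/
def envLaw (μ : Measure (Set.Icc (0 : ℝ) 1)) : Measure Env :=
  Measure.infinitePi fun _ : ℤ => μ

/-- First standing assumption: `E[log ρ_0] < 0` and `E[ρ_0 ^ s] = 1` with `s > 1`. The expectation of
`log ρ_0 ∈ [-∞, ∞]` may be `-∞`; that it exists and is negative means that the expectation of the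
positive part is less than the expectation of the negative part. -/
def BallisticAssumption (μ : Measure (Set.Icc (0 : ℝ) 1)) (s : ℝ) : Prop :=
  1 < s ∧
  ∫⁻ p, (ENNReal.log (odds p)).toENNReal ∂μ < ∫⁻ p, (-ENNReal.log (odds p)).toENNReal ∂μ ∧
  ∫⁻ p, odds p ^ s ∂μ = 1

/-- Second standing assumption: `log ρ_0` is non-lattice, that is, it is not almost surely in `h ℤ` for
any `h > 0`, and `E[ρ_0 ^ s log ρ_0] < ∞` (the function `r ^ s log r`, which is `0` at `r = 0`, is
bounded below, so this is integrability). -/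
def RegularityAssumption (μ : Measure (Set.Icc (0 : ℝ) 1)) (s : ℝ) : Prop :=
  (∀ h : ℝ, 0 < h → ¬ ∀ᵐ p ∂μ, ∃ k : ℤ, ENNReal.log (odds p) = (((k : ℝ) * h : ℝ) : EReal)) ∧
  Integrable (fun p => (odds p).toReal ^ s * Real.log (odds p).toReal) μ

/-! ### Ladder points -/

/-- `ν_n` for `n = 0, 1, 2, …`. In terms of the potential `V`, `Π_{k,y-1} < 1` says `V y < V k`; the form
with products also makes sense if some `ρ_x` vanish. -/
def ladderPos (ω : Env) : ℕ → ℤ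
  | 0 => sSup {y : ℤ | y ≤ 0 ∧ ∀ k < y, rhoProd ω k (y - 1) < 1}
  | n + 1 => sInf {x : ℤ | ladderPos ω n < x ∧ rhoProd ω (ladderPos ω n) (x - 1) < 1}

/-- `ν_{-n}` for `n = 0, 1, 2, …`. -/
def ladderNeg (ω : Env) : ℕ → ℤ
  | 0 => ladderPos ω 0
  | n + 1 => sSup {y : ℤ | y < ladderNeg ω n ∧ ∀ k < y, rhoProd ω k (y - 1) < 1}

/-- The ladder points `ν_i`, `i ∈ ℤ`. -/
def ladder (ω : Env) : ℤ → ℤ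
  | Int.ofNat n => ladderPos ω n
  | Int.negSucc n => ladderNeg ω (n + 1)

/-- `M_i = max {exp (V j - V ν_i) : ν_i < j ≤ ν_{i+1}} = max {Π_{ν_i,j} : ν_i ≤ j < ν_{i+1}}`. -/
def height (ω : Env) (i : ℤ) : ℝ≥0∞ :=
  ⨆ j ∈ Set.Ico (ladder ω i) (ladder ω (i + 1)), rhoProd ω (ladder ω i) j

/-- `Q = α(· | ν_0 = 0)`. -/
def ladderLaw (μ : Measure (Set.Icc (0 : ℝ) 1)) : Measure Env :=
  cond (envLaw μ) {ω | ladder ω 0 = 0}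

/-! ### The quenched random walk -/

/-- The transition kernel of the walk in the environment `ω`: from `x`, go to `x + 1` with probability
`ω_x` and to `x - 1` with probability `1 - ω_x`. -/
def step (ω : Env) : Kernel ℤ ℤ where
  toFun x := ENNReal.ofReal (ω x : ℝ) • Measure.dirac (x + 1) +
    ENNReal.ofReal (1 - (ω x : ℝ)) • Measure.dirac (x - 1)
  measurable' := Measurable.of_discrete

instance (ω : Env) : IsMarkovKernel (step ω) := ⟨fun x => ⟨by
  have h0 : (0 : ℝ) ≤ (ω x : ℝ) := (ω x).2.1
  have h1 : (0 : ℝ) ≤ 1 - (ω x : ℝ) := sub_nonneg.2 (ω x).2.2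
  change (ENNReal.ofReal (ω x : ℝ) • Measure.dirac (x + 1) +
    ENNReal.ofReal (1 - (ω x : ℝ)) • Measure.dirac (x - 1) : Measure ℤ) Set.univ = 1
  simp [← ENNReal.ofReal_add h0 h1]⟩⟩

/-- The law of `X_{n+1}` given `X_0, …, X_n`, namely `step ω` applied to `X_n`. -/
def stepFromPast (ω : Env) (n : ℕ) : Kernel (Finset.Iic n → ℤ) ℤ :=
  (step ω).comap (fun h => h ⟨n, Finset.mem_Iic.2 le_rfl⟩) (measurable_pi_apply _)

instance (ω : Env) (n : ℕ) : IsMarkovKernel (stepFromPast ω n) := by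
  unfold stepFromPast; infer_instance

/-- The quenched law `P_ω^x` on paths `(X_n)_{n ∈ ℕ}`, with `X_0 = x`. -/
def quenchedLaw (ω : Env) (x : ℤ) : Measure (ℕ → ℤ) :=
  Kernel.traj (X := fun _ => ℤ) (stepFromPast ω) 0 fun _ => x

/-- The hitting time `T_y = inf {n ≥ 0 : X_n = y}`, equal to `∞` if `y` is never hit. -/
def hitTime (y : ℤ) (X : ℕ → ℤ) : ℝ≥0∞ := ⨅ (n : ℕ) (_ : X n = y), (n : ℝ≥0∞)

/-- `β_i = E_ω^{ν_i}[T_{ν_{i+1}}]`. -/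
def crossing (ω : Env) (i : ℤ) : ℝ≥0∞ :=
  ∫⁻ X, hitTime (ladder ω (i + 1)) X ∂(quenchedLaw ω (ladder ω i))

/-- `E_Q[β_0]`. -/
def meanCrossing (μ : Measure (Set.Icc (0 : ℝ) 1)) : ℝ≥0∞ :=
  ∫⁻ ω, crossing ω 0 ∂(ladderLaw μ)

/-- The truncated crossing time `β_i 1{M_i ≤ b}`. -/
def smallCrossing (b : ℝ) (ω : Env) (i : ℤ) : ℝ≥0∞ :=
  {ω' : Env | height ω' i ≤ ENNReal.ofReal b}.indicator (fun ω' => crossing ω' i) ω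

end RWRE

end

/-! In the environment seen from a ladder point, all that matters of the past is
`W = ∑_{k ≥ 1} Π_{y-k,y-1}`, which is independent of the i.i.d. ratios ahead. The first descent of
their partial products below `1` ends the block; the crossing time of the block is affine in `W`,
and so is the new value of `W`, with a factor less than `1`. Successive pairs (`W`, ratios ahead)
form a stationary Markov chain under `Q`. Hence `E_Q[β_0] < ∞`, and for `κ > E_Q[β_0]` there are
`c, δ > 0` such that, from any value `w` of `W`, the crossing time of a block plus `c` times the new
value of `W` has mean at most `(κ + c w) / (1 + δ)`.

Strict convexity turns `E[ρ_0 ^ s] = 1` into `r = E[ρ_0] < 1`. A block fails to be moderate, that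
is of length at most `h` with `W ≤ 2h`, with probability at most of order `r ^ h`. On moderate
blocks of height at most `b` the crossing time is of order at most `h² b`, so the drift inequality
exponentiates at rate `θ / (h² b)`: the probability that `N` truncated crossing times have sum at
least `N κ`, for a slightly larger `κ`, is at most of order `N r ^ h + exp (-θ N / (h² b))`. Take
`h` of order `(log n)²`. -/

open scoped NNReal Topology

noncomputable section

namespace RWRE

/-! ### Markov chains killed on a set -/

section MarkovChain

variable {E : Type*} {A : Set E}

/-- The paths that stay outside `A` up to time `n`. -/
def avoiding (A : Set E) (n : ℕ) : Set (ℕ → E) := {X | ∀ k ≤ n, X k ∉ A}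

lemma antitone_avoiding : Antitone (avoiding A) := fun _ _ hnm _ hX k hk => hX k (hk.trans hnm)

variable [MeasurableSpace E]

lemma measurableSet_avoiding (hA : MeasurableSet A) (n : ℕ) : MeasurableSet (avoiding A n) := by
  have h : avoiding A n = ⋂ k ∈ Set.Iic n, (fun X : ℕ → E => X k) ⁻¹' Aᶜ := by
    ext; simp [avoiding]
  rw [h]
  exact .biInter (Set.to_countable _) fun k _ => measurable_pi_apply k hA.compl

variable (κ : Kernel E E)

/-- The transition kernel `κ` of a Markov chain as a function of the whole past: only the last
state matters. -/
def kernelFromPast (n : ℕ) : Kernel (Finset.Iic n → E) E :=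
  κ.comap (fun h => h ⟨n, Finset.mem_Iic.2 le_rfl⟩) (measurable_pi_apply _)

instance [IsMarkovKernel κ] (n : ℕ) : IsMarkovKernel (kernelFromPast κ n) := by
  unfold kernelFromPast; infer_instance

/-- The law of the Markov chain with transition kernel `κ` started at `x`. -/
def chainLaw [IsMarkovKernel κ] (x : E) : Measure (ℕ → E) :=
  Kernel.traj (X := fun _ => E) (kernelFromPast κ) 0 fun _ => x

instance [IsMarkovKernel κ] (x : E) : IsProbabilityMeasure (chainLaw κ x) := by
  unfold chainLaw; infer_instance

/-- `P^x (T_A > n)`, where `T_A` is the hitting time of `A`. -/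
def survival [IsMarkovKernel κ] (A : Set E) (n : ℕ) (x : E) : ℝ≥0∞ :=
  chainLaw κ x (avoiding A n)

/-- The transition operator of the chain killed on `A`. -/
def killedOp (A : Set E) (g : E → ℝ≥0∞) (x : E) : ℝ≥0∞ := ∫⁻ z in Aᶜ, g z ∂κ x

lemma measurable_killedOp [IsSFiniteKernel κ] (hA : MeasurableSet A) {g : E → ℝ≥0∞}
    (hg : Measurable g) : Measurable (killedOp κ A g) :=
  hg.setLIntegral_kernel hA.compl

variable [IsMarkovKernel κ]

lemma map_eval_zero_chainLaw (x : E) : (chainLaw κ x).map (fun X => X 0) = Measure.dirac x := by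
  have h := Kernel.traj_map_frestrictLe_apply (X := fun _ : ℕ => E) (κ := kernelFromPast κ) 0 0
    fun _ => x
  rw [Kernel.partialTraj_self, Kernel.id_apply] at h
  have h_eval : Measurable fun g : Finset.Iic 0 → E => g ⟨0, by simp⟩ := measurable_pi_apply _
  calc (chainLaw κ x).map (fun X => X 0)
      = ((chainLaw κ x).map (Preorder.frestrictLe 0)).map (fun g => g ⟨0, by simp⟩) := by
        rw [Measure.map_map h_eval (Preorder.measurable_frestrictLe 0)]
        rfl
    _ = Measure.dirac x := by rw [chainLaw, h, Measure.map_dirac' h_eval]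

lemma map_prodMk_chainLaw (x : E) (n : ℕ) :
    (chainLaw κ x).map (fun X => (Preorder.frestrictLe (π := fun _ => E) n X, X (n + 1))) =
      ((chainLaw κ x).map (Preorder.frestrictLe n)) ⊗ₘ kernelFromPast κ n := by
  rw [chainLaw, Kernel.traj_map_frestrictLe_apply, Kernel.partialTraj_compProd_eq_map_traj
    (Nat.zero_le n)]

lemma setLIntegral_avoiding_succ (hA : MeasurableSet A) {g : E → ℝ≥0∞} (hg : Measurable g)
    (x : E) (n : ℕ) :
    ∫⁻ X in avoiding A (n + 1), g (X (n + 1)) ∂chainLaw κ x =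
      ∫⁻ X in avoiding A n, killedOp κ A g (X n) ∂chainLaw κ x := by
  have hS : MeasurableSet {h : Finset.Iic n → E | ∀ k, h k ∉ A} := by
    rw [Set.ofPred_forall]
    exact .iInter fun k => hA.compl.preimage (measurable_pi_apply k)
  have h_avoiding : avoiding A n = Preorder.frestrictLe (π := fun _ => E) n ⁻¹'
      {h : Finset.Iic n → E | ∀ k, h k ∉ A} := by
    ext X; simp [avoiding]
  have h_succ : avoiding A (n + 1) =
      (fun X => (Preorder.frestrictLe (π := fun _ => E) n X, X (n + 1))) ⁻¹'
        ({h : Finset.Iic n → E | ∀ k, h k ∉ A} ×ˢ Aᶜ) := by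
    ext X; simp [avoiding, Nat.le_succ_iff, or_imp, forall_and]
  rw [h_succ, ← setLIntegral_map (f := fun z : (Finset.Iic n → E) × E => g z.2)
    (hS.prod hA.compl) (by fun_prop) (by fun_prop), map_prodMk_chainLaw,
    Measure.setLIntegral_compProd (by fun_prop) hS hA.compl, h_avoiding]
  exact setLIntegral_map hS ((measurable_killedOp κ hA hg).comp
    (measurable_pi_apply (⟨n, by simp⟩ : Finset.Iic n))) (by fun_prop)

lemma survival_zero (hA : MeasurableSet A) (x : E) : survival κ A 0 x = Aᶜ.indicator 1 x := by
  rw [← Measure.dirac_apply' x hA.compl, ← map_eval_zero_chainLaw κ x,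
    Measure.map_apply (by fun_prop) hA.compl]
  exact congrArg _ (Set.ext fun X => by simp [avoiding])

lemma survival_antitone (x : E) : Antitone fun n => survival κ A n x :=
  fun _ _ hnm => measure_mono (antitone_avoiding hnm)

lemma survival_le_one (n : ℕ) (x : E) : survival κ A n x ≤ 1 := prob_le_one

lemma survival_of_mem (hA : MeasurableSet A) {x : E} (hx : x ∈ A) (n : ℕ) :
    survival κ A n x = 0 :=
  nonpos_iff_eq_zero.1 <| (survival_antitone κ x n.zero_le).trans
    (by simp [survival_zero κ hA, hx])

lemma setLIntegral_avoiding_eq_iterate (hA : MeasurableSet A) {g : E → ℝ≥0∞} (hg : Measurable g)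
    {x : E} (hx : x ∉ A) (n : ℕ) :
    ∫⁻ X in avoiding A n, g (X n) ∂chainLaw κ x = (killedOp κ A)^[n] g x := by
  induction n generalizing g with
  | zero =>
    have h_sure : chainLaw κ x (avoiding A 0)ᶜ = 0 := by
      rw [prob_compl_eq_zero_iff (measurableSet_avoiding hA 0)]
      exact (survival_zero κ hA x).trans (Set.indicator_of_mem hx 1)
    rw [Measure.restrict_eq_self_of_ae_mem (s := avoiding A 0) (mem_ae_iff.2 h_sure),
      ← lintegral_map hg (measurable_pi_apply 0), map_eval_zero_chainLaw, lintegral_dirac' x hg]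
    rfl
  | succ n ih =>
    rw [setLIntegral_avoiding_succ κ hA hg, ih (measurable_killedOp κ hA hg)]
    rfl

lemma survival_succ (hA : MeasurableSet A) {x : E} (hx : x ∉ A) (n : ℕ) :
    survival κ A (n + 1) x = ∫⁻ z, survival κ A n z ∂κ x := by
  have h_iterate : ∀ {z}, z ∉ A → ∀ m, survival κ A m z = (killedOp κ A)^[m] 1 z := fun hz m => by
    rw [← setLIntegral_avoiding_eq_iterate κ hA measurable_one hz m]
    simp [survival]
  have h_support : ∫⁻ z in A, survival κ A n z ∂κ x = 0 :=
    setLIntegral_eq_zero hA fun z hz => survival_of_mem κ hA hz n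
  rw [h_iterate hx, Function.iterate_succ_apply', killedOp,
    ← lintegral_add_compl (fun z => survival κ A n z) hA, h_support, zero_add]
  exact setLIntegral_congr_fun hA.compl fun z hz => (h_iterate hz n).symm

end MarkovChain

/-! ### Two-sided sequences and the affine recursion -/

section Sequences

variable {X : Type*}

/-- The terms of a two-sided sequence strictly to the left of `y`, read leftwards. -/
def past (ω : ℤ → X) (y : ℤ) : ℕ → X := fun k => ω (y - 1 - k)

/-- The terms of a two-sided sequence to the right of `y`, starting with the one at `y`. -/
def future (ω : ℤ → X) (y : ℤ) : ℕ → X := fun k => ω (y + k)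

/-- The product of the first `k` terms of a sequence of ratios. -/
def prefixProd (r : ℕ → ℝ≥0∞) (k : ℕ) : ℝ≥0∞ := ∏ i ∈ Finset.range k, r i

/-- The affine recursion `w ↦ r (1 + w)` run along a sequence of ratios, starting from `w`. -/
def affineRec (w : ℝ≥0∞) (r : ℕ → ℝ≥0∞) : ℕ → ℝ≥0∞
  | 0 => w
  | k + 1 => r k * (1 + affineRec w r k)

/-- The perpetuity `r₀ + r₀ r₁ + r₀ r₁ r₂ + ⋯`. Evaluated along the past of a two-sided sequence, it
is the stationary solution of the affine recursion. -/
def perpetuity (r : ℕ → ℝ≥0∞) : ℝ≥0∞ := ∑' k, prefixProd r (k + 1)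

@[simp] lemma prefixProd_zero (r : ℕ → ℝ≥0∞) : prefixProd r 0 = 1 := by simp [prefixProd]

lemma prefixProd_succ (r : ℕ → ℝ≥0∞) (k : ℕ) : prefixProd r (k + 1) = prefixProd r k * r k :=
  Finset.prod_range_succ _ _

lemma prefixProd_past_succ (ρ : ℤ → ℝ≥0∞) (x : ℤ) (k : ℕ) :
    prefixProd (past ρ (x + 1)) (k + 1) = ρ x * prefixProd (past ρ x) k := by
  have h_tail : ∀ i : ℕ, past ρ (x + 1) (i + 1) = past ρ x i := fun i => by
    simp only [past]
    congr 1
    omega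
  have h_head : past ρ (x + 1) 0 = ρ x := by simp [past]
  simp only [prefixProd, Finset.prod_range_succ', h_tail, h_head, mul_comm]

lemma perpetuity_past_succ (ρ : ℤ → ℝ≥0∞) (x : ℤ) :
    perpetuity (past ρ (x + 1)) = ρ x * (1 + perpetuity (past ρ x)) := by
  simp only [perpetuity, prefixProd_past_succ, ENNReal.tsum_mul_left]
  rw [tsum_eq_zero_add' ENNReal.summable, prefixProd_zero]

lemma affineRec_perpetuity_past (ρ : ℤ → ℝ≥0∞) (x : ℤ) (k : ℕ) :
    affineRec (perpetuity (past ρ x)) (future ρ x) k = perpetuity (past ρ (x + k)) := by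
  induction k with
  | zero => simp [affineRec]
  | succ k ih => rw [affineRec, ih, Nat.cast_succ, ← add_assoc, perpetuity_past_succ, future]

end Sequences

/-! ### Quenched hitting times -/

lemma hitTime_eq_tsum (y : ℤ) (X : ℕ → ℤ) :
    hitTime y X = ∑' n : ℕ, (avoiding {y} n).indicator 1 X := by
  classical
  by_cases h : ∃ n, X n = y
  · have h_hit : hitTime y X = (Nat.find h : ℝ≥0∞) := by
      refine le_antisymm (iInf₂_le (Nat.find h) (Nat.find_spec h)) (le_iInf₂ fun n hn => ?_)
      exact_mod_cast Nat.find_min' h hn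
    have h_avoid : ∀ n, X ∈ avoiding {y} n ↔ n ∈ Finset.range (Nat.find h) := fun n => by
      simp [avoiding, Nat.lt_find_iff]
    simp only [Set.indicator_apply, h_avoid, Pi.one_apply]
    rw [h_hit, tsum_eq_sum fun n hn => if_neg hn, Finset.sum_congr rfl fun n hn => if_pos hn]
    simp
  · push Not at h
    have h_avoid : ∀ n, X ∈ avoiding {y} n := fun n k _ => h k
    simp [hitTime, h, h_avoid]

lemma lintegral_hitTime (κ : Kernel ℤ ℤ) [IsMarkovKernel κ] (x y : ℤ) :
    ∫⁻ X, hitTime y X ∂chainLaw κ x = ∑' n, survival κ {y} n x := by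
  have h_meas := measurableSet_avoiding (measurableSet_singleton y)
  simp_rw [hitTime_eq_tsum]
  rw [lintegral_tsum fun n => (measurable_one.indicator (h_meas n)).aemeasurable]
  exact tsum_congr fun n => lintegral_indicator_one (h_meas n)

lemma ofReal_add_ofReal_one_sub (p : Set.Icc (0 : ℝ) 1) :
    ENNReal.ofReal (p : ℝ) + ENNReal.ofReal (1 - (p : ℝ)) = 1 := by
  simp [← ENNReal.ofReal_add p.2.1 (sub_nonneg.2 p.2.2)]

lemma ofReal_mul_odds {p : Set.Icc (0 : ℝ) 1} (hp : 0 < (p : ℝ)) :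
    ENNReal.ofReal (p : ℝ) * odds p = ENNReal.ofReal (1 - (p : ℝ)) :=
  ENNReal.mul_div_cancel (by simpa using hp) ENNReal.ofReal_ne_top

lemma lintegral_step (ω : Env) (x : ℤ) (f : ℤ → ℝ≥0∞) :
    ∫⁻ z, f z ∂step ω x =
      ENNReal.ofReal (ω x : ℝ) * f (x + 1) + ENNReal.ofReal (1 - (ω x : ℝ)) * f (x - 1) := by
  change ∫⁻ z, f z ∂(ENNReal.ofReal (ω x : ℝ) • Measure.dirac (x + 1) +
    ENNReal.ofReal (1 - (ω x : ℝ)) • Measure.dirac (x - 1) : Measure ℤ) = _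
  simp [lintegral_add_measure]

/-- `∑_{j < k} (1 + 2 W_{y-j})` with `W` the stationary solution of the affine recursion: the mean
time the walk in the environment `ω` needs to go from `y - k` to `y`. -/
def meanHit (ω : Env) (y : ℤ) (k : ℕ) : ℝ≥0∞ :=
  ∑ j ∈ Finset.range k, (1 + 2 * perpetuity (past (rho ω) (y - j)))

lemma meanHit_succ (ω : Env) (y : ℤ) (k : ℕ) :
    meanHit ω y (k + 1) = meanHit ω y k + (1 + 2 * perpetuity (past (rho ω) (y - k))) :=
  Finset.sum_range_succ _ _

section Walk

variable (ω : Env) (y : ℤ)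

lemma survival_step_succ {x : ℤ} (hx : x ≠ y) (n : ℕ) :
    survival (step ω) {y} (n + 1) x =
      ENNReal.ofReal (ω x : ℝ) * survival (step ω) {y} n (x + 1) +
        ENNReal.ofReal (1 - (ω x : ℝ)) * survival (step ω) {y} n (x - 1) := by
  rw [survival_succ _ (measurableSet_singleton y) hx, lintegral_step]

/-- On its way from `x` to `y` the walk visits `x + 1`, and not before time `1`. -/
lemma survival_step_add_one_le {x : ℤ} (hx : x < y) (n : ℕ) :
    survival (step ω) {y} n (x + 1) ≤ survival (step ω) {y} (n + 1) x := by
  have h_of_le : ∀ n : ℕ, ∀ x < y,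
      survival (step ω) {y} n (x + 1) ≤ survival (step ω) {y} n (x - 1) →
        survival (step ω) {y} n (x + 1) ≤ survival (step ω) {y} (n + 1) x := fun n x hx h => by
    calc survival (step ω) {y} n (x + 1)
        = ENNReal.ofReal (ω x : ℝ) * survival (step ω) {y} n (x + 1) +
            ENNReal.ofReal (1 - (ω x : ℝ)) * survival (step ω) {y} n (x + 1) := by
          rw [← add_mul, ofReal_add_ofReal_one_sub, one_mul]
      _ ≤ survival (step ω) {y} (n + 1) x := by
          rw [survival_step_succ ω y hx.ne]
          gcongr
  have h_antitone := survival_antitone (step ω) (A := {y})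
  induction n generalizing x with
  | zero =>
    refine h_of_le 0 x hx ((survival_le_one _ _ _).trans_eq ?_)
    rw [survival_zero _ (measurableSet_singleton y), Set.indicator_of_mem (by grind), Pi.one_apply]
  | succ n ih =>
    refine h_of_le (n + 1) x hx ?_
    calc survival (step ω) {y} (n + 1) (x + 1)
        ≤ survival (step ω) {y} n (x + 1) := h_antitone _ n.le_succ
      _ ≤ survival (step ω) {y} (n + 1) x := ih hx
      _ ≤ survival (step ω) {y} n (x - 1 + 1) := by
          rw [sub_add_cancel]
          exact h_antitone x n.le_succ
      _ ≤ survival (step ω) {y} (n + 1) (x - 1) := ih (by omega)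

lemma tsum_survival_step {x : ℤ} (hx : x < y) :
    ∑' n, survival (step ω) {y} n x =
      1 + (ENNReal.ofReal (ω x : ℝ) * ∑' n, survival (step ω) {y} n (x + 1) +
        ENNReal.ofReal (1 - (ω x : ℝ)) * ∑' n, survival (step ω) {y} n (x - 1)) := by
  rw [tsum_eq_zero_add' ENNReal.summable, survival_zero _ (measurableSet_singleton y),
    Set.indicator_of_mem (by simpa using hx.ne), ← ENNReal.tsum_mul_left, ← ENNReal.tsum_mul_left,
    ← ENNReal.tsum_add]
  simp only [survival_step_succ ω y hx.ne, Pi.one_apply]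

variable {ω} (hω : ∀ x, 0 < (ω x : ℝ))
include hω

lemma sum_survival_step_le (N k : ℕ) :
    ∑ n ∈ Finset.range N, survival (step ω) {y} n (y - k) ≤ meanHit ω y k := by
  induction N generalizing k with
  | zero => simp
  | succ N ih =>
    rcases k with _ | k
    · simp [survival_of_mem]
    obtain ⟨x, hx⟩ : ∃ x : ℤ, x = y - (k + 1 : ℕ) := ⟨_, rfl⟩
    have h_right := ih k
    have h_left := ih (k + 2)
    rw [show y - (k : ℤ) = x + 1 by grind] at h_right
    rw [show y - ((k + 2 : ℕ) : ℤ) = x - 1 by grind] at h_left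
    have h_mean₁ : meanHit ω y (k + 1) =
        meanHit ω y k + (1 + 2 * (rho ω x * (1 + perpetuity (past (rho ω) x)))) := by
      rw [meanHit_succ, show y - (k : ℤ) = x + 1 by grind, perpetuity_past_succ]
    have h_mean₂ : meanHit ω y (k + 2) =
        meanHit ω y (k + 1) + (1 + 2 * perpetuity (past (rho ω) x)) := by
      rw [meanHit_succ, hx]
    rw [← hx, Finset.sum_range_succ']
    simp only [survival_step_succ ω y (show x ≠ y by grind), Finset.sum_add_distrib,
      ← Finset.mul_sum]
    have hpq := ofReal_add_ofReal_one_sub (ω x)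
    have hpo : ENNReal.ofReal (ω x : ℝ) * rho ω x = _ := ofReal_mul_odds (hω x)
    generalize ENNReal.ofReal (ω x : ℝ) = p, ENNReal.ofReal (1 - (ω x : ℝ)) = q,
      perpetuity (past (rho ω) x) = W at *
    calc p * ∑ n ∈ Finset.range N, survival (step ω) {y} n (x + 1) +
          q * ∑ n ∈ Finset.range N, survival (step ω) {y} n (x - 1) + survival (step ω) {y} 0 x
        ≤ p * meanHit ω y k + q * meanHit ω y (k + 2) + 1 := by
          gcongr
          exact survival_le_one _ _ _
      _ = p * meanHit ω y k + q * meanHit ω y (k + 1) + (q * (1 + 2 * W) + (p + q)) := by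
          rw [h_mean₂, hpq]
          ring
      _ = p * meanHit ω y (k + 1) + q * meanHit ω y (k + 1) := by rw [← hpo, h_mean₁]; ring
      _ = meanHit ω y (k + 1) := by rw [← add_mul, hpq, one_mul]

lemma tsum_survival_step_le (k : ℕ) :
    ∑' n, survival (step ω) {y} n (y - k) ≤ meanHit ω y k :=
  ENNReal.tsum_le_of_sum_range_le fun N => sum_survival_step_le y hω N k

variable (hW : ∀ x, perpetuity (past (rho ω) x) ≠ ∞)
include hW

lemma tsum_survival_step_ne_top {x : ℤ} (hx : x ≤ y) :
    ∑' n, survival (step ω) {y} n x ≠ ∞ := by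
  have h := tsum_survival_step_le y hω (y - x).toNat
  rw [show y - ((y - x).toNat : ℤ) = x by omega] at h
  exact ne_top_of_le_ne_top (ENNReal.sum_ne_top.2 fun j _ => by finiteness [hW (y - j)]) h

lemma tsum_survival_step_add_le (m : ℕ) {x : ℤ} (hx : x < y) :
    ∑' n, survival (step ω) {y} n (x + 1) +
      (1 + 2 * ∑ k ∈ Finset.range m, prefixProd (past (rho ω) (x + 1)) (k + 1)) ≤
        ∑' n, survival (step ω) {y} n x := by
  induction m generalizing x with
  | zero =>
    rw [Finset.sum_range_zero, mul_zero, add_zero, add_comm,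
      tsum_eq_zero_add' (f := fun n => survival (step ω) {y} n x) ENNReal.summable,
      survival_zero _ (measurableSet_singleton y), Set.indicator_of_mem (by grind), Pi.one_apply]
    gcongr
    exact survival_step_add_one_le ω y hx _
  | succ m ih =>
    have h_left := ih (show x - 1 < y by omega)
    rw [sub_add_cancel] at h_left
    have h_fin := tsum_survival_step_ne_top y hω hW hx.le
    have h_rec := tsum_survival_step ω y hx
    have h_sum : ∑ k ∈ Finset.range (m + 1), prefixProd (past (rho ω) (x + 1)) (k + 1) =
        rho ω x * (1 + ∑ k ∈ Finset.range m, prefixProd (past (rho ω) x) (k + 1)) := by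
      simp only [prefixProd_past_succ, ← Finset.mul_sum]
      rw [Finset.sum_range_succ', prefixProd_zero, add_comm 1]
    rw [h_sum]
    have hpq := ofReal_add_ofReal_one_sub (ω x)
    have hpo : ENNReal.ofReal (ω x : ℝ) * rho ω x = _ := ofReal_mul_odds (hω x)
    have hp : ENNReal.ofReal (ω x : ℝ) ≠ 0 := by simpa using hω x
    have hp' : ENNReal.ofReal (ω x : ℝ) ≠ ∞ := ENNReal.ofReal_ne_top
    have hq' : ENNReal.ofReal (1 - (ω x : ℝ)) ≠ ∞ := ENNReal.ofReal_ne_top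
    generalize ENNReal.ofReal (ω x : ℝ) = p, ENNReal.ofReal (1 - (ω x : ℝ)) = q,
      ∑' n, survival (step ω) {y} n x = D, ∑' n, survival (step ω) {y} n (x + 1) = D₁,
      ∑ k ∈ Finset.range m, prefixProd (past (rho ω) x) (k + 1) = S at *
    have h_mul : q * D + p * (D₁ + (1 + 2 * (rho ω x * (1 + S)))) ≤ q * D + p * D := by
      calc q * D + p * (D₁ + (1 + 2 * (rho ω x * (1 + S))))
          = q * D + p * D₁ + p + 2 * (p * rho ω x) * (1 + S) := by ring
        _ = (p + q) + (p * D₁ + q * (D + (1 + 2 * S))) := by rw [hpo]; ring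
        _ ≤ D := by rw [hpq, h_rec]; gcongr; rwa [← h_rec]
        _ = q * D + p * D := by rw [← add_mul, add_comm q, hpq, one_mul]
    rw [ENNReal.add_le_add_iff_left (by finiteness)] at h_mul
    exact (ENNReal.mul_le_mul_iff_right hp hp').1 h_mul

lemma tsum_survival_step_eq_meanHit (k : ℕ) :
    ∑' n, survival (step ω) {y} n (y - k) = meanHit ω y k := by
  refine le_antisymm (tsum_survival_step_le y hω k) ?_
  induction k with
  | zero => simp [meanHit]
  | succ k ih =>
    rw [meanHit_succ, perpetuity, ENNReal.tsum_eq_iSup_nat, ENNReal.mul_iSup,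
      ENNReal.add_iSup, ENNReal.add_iSup]
    refine iSup_le fun m => ?_
    have h := tsum_survival_step_add_le y hω hW m (show y - (k + 1 : ℕ) < y by omega)
    rw [show y - ((k + 1 : ℕ) : ℤ) + 1 = y - k by grind] at h
    exact (add_le_add_left ih _).trans h

theorem lintegral_hitTime_quenchedLaw (x : ℤ) (k : ℕ) :
    ∫⁻ X, hitTime (x + k) X ∂quenchedLaw ω x = ∑ j ∈ Finset.range k,
      (1 + 2 * affineRec (perpetuity (past (rho ω) x)) (future (rho ω) x) (j + 1)) := by
  have h := tsum_survival_step_eq_meanHit (x + k) hω hW k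
  rw [add_sub_cancel_right, meanHit, ← Finset.sum_range_reflect] at h
  refine (lintegral_hitTime (step ω) x (x + k)).trans (h.trans ?_)
  refine Finset.sum_congr rfl fun j hj => ?_
  rw [affineRec_perpetuity_past, show x + k - ((k - 1 - j : ℕ) : ℤ) = x + (j + 1 : ℕ) by
    have := Finset.mem_range.1 hj; omega]

end Walk

/-! ### Independent identically distributed sequences -/

section Iid

variable {X : Type*}

/-- The first `m` terms of the first sequence, followed by the second sequence. -/
def splice (m : ℕ) (z : (ℕ → X) × (ℕ → X)) : ℕ → X := fun i => if i < m then z.1 i else z.2 (i - m)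

/-- The sequence without its first `m` terms. -/
def dropSeq (m : ℕ) (η : ℕ → X) : ℕ → X := fun i => η (m + i)

/-- Translation of a two-sided sequence. -/
def shift (m : ℤ) (ω : ℤ → X) : ℤ → X := fun x => ω (x + m)

@[simp] lemma dropSeq_splice (m : ℕ) (z : (ℕ → X) × (ℕ → X)) : dropSeq m (splice m z) = z.2 := by
  ext i
  simp [dropSeq, splice]

lemma splice_of_lt {m i : ℕ} (h : i < m) (z : (ℕ → X) × (ℕ → X)) : splice m z i = z.1 i := if_pos h

variable [MeasurableSpace X]

/-- The law of an i.i.d. family, indexed by `ι`, of random variables with law `ν`. -/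
def iidLaw (ι : Type*) (ν : Measure X) : Measure (ι → X) := Measure.infinitePi fun _ : ι => ν

@[fun_prop] lemma measurable_past (y : ℤ) : Measurable fun ω : ℤ → X => past ω y := by
  unfold past; fun_prop

@[fun_prop] lemma measurable_future (y : ℤ) : Measurable fun ω : ℤ → X => future ω y := by
  unfold future; fun_prop

@[fun_prop] lemma measurable_dropSeq (m : ℕ) : Measurable (dropSeq (X := X) m) := by
  unfold dropSeq; fun_prop

variable (ν : Measure X) [IsProbabilityMeasure ν]

instance (ι : Type*) : IsProbabilityMeasure (iidLaw ι ν) := by unfold iidLaw; infer_instance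

lemma measurePreserving_eval_iidLaw {ι : Type*} (i : ι) :
    MeasurePreserving (fun ω : ι → X => ω i) (iidLaw ι ν) ν :=
  measurePreserving_eval_infinitePi (fun _ : ι => ν) i

lemma measurePreserving_comp_iidLaw (ι : Type*) {Y : Type*} [MeasurableSpace Y] {f : X → Y}
    (hf : Measurable f) :
    MeasurePreserving (fun (ω : ι → X) i => f (ω i)) (iidLaw ι ν) (iidLaw ι (ν.map f)) :=
  ⟨by fun_prop, Measure.infinitePi_map_pi (fun _ : ι => ν) fun _ => hf⟩

lemma measurePreserving_sumElim_iidLaw (κ₁ κ₂ : Type*) :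
    MeasurePreserving (fun z : (κ₁ → X) × (κ₂ → X) => (Sum.elim z.1 z.2 : κ₁ ⊕ κ₂ → X))
      ((iidLaw κ₁ ν).prod (iidLaw κ₂ ν)) (iidLaw (κ₁ ⊕ κ₂) ν) := by
  have h_meas : Measurable fun z : (κ₁ → X) × (κ₂ → X) => (Sum.elim z.1 z.2 : κ₁ ⊕ κ₂ → X) :=
    measurable_pi_lambda _ fun i => by
      cases i <;> simp only [Sum.elim_inl, Sum.elim_inr] <;> fun_prop
  refine ⟨h_meas, Measure.eq_infinitePi _ fun s t ht => ?_⟩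
  have h_preimage : (fun z : (κ₁ → X) × (κ₂ → X) => (Sum.elim z.1 z.2 : κ₁ ⊕ κ₂ → X)) ⁻¹'
      (s : Set (κ₁ ⊕ κ₂)).pi t = (Set.pi (s.toLeft : Set κ₁) fun i => t (.inl i)) ×ˢ
        (Set.pi (s.toRight : Set κ₂) fun i => t (.inr i)) := by
    ext z
    simp [Set.mem_pi]
  rw [Measure.map_apply h_meas (.pi s.countable_toSet fun i _ => ht i), h_preimage,
    Measure.prod_prod, iidLaw, iidLaw, Measure.infinitePi_pi _ fun i _ => ht _,
    Measure.infinitePi_pi _ fun i _ => ht _]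
  nth_rw 3 [← Finset.toLeft_disjSum_toRight (u := s)]
  rw [Finset.prod_disjSum]

lemma measurePreserving_glue_iidLaw {ι κ₁ κ₂ : Type*} {e : ι → κ₁ ⊕ κ₂}
    (he : Function.Injective e) :
    MeasurePreserving (fun (z : (κ₁ → X) × (κ₂ → X)) i => (Sum.elim z.1 z.2 (e i) : X))
      ((iidLaw κ₁ ν).prod (iidLaw κ₂ ν)) (iidLaw ι ν) :=
  MeasurePreserving.comp (g := fun (y : κ₁ ⊕ κ₂ → X) i => y (e i))
    ⟨by fun_prop, Measure.map_infinitePi_infinitePi_of_inj he⟩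
    (measurePreserving_sumElim_iidLaw ν κ₁ κ₂)

lemma measurePreserving_splice (m : ℕ) :
    MeasurePreserving (splice m) ((iidLaw ℕ ν).prod (iidLaw ℕ ν)) (iidLaw ℕ ν) := by
  have h_inj : Function.Injective
      fun i : ℕ => if i < m then (Sum.inl i : ℕ ⊕ ℕ) else Sum.inr (i - m) := fun i j h => by grind
  convert measurePreserving_glue_iidLaw ν h_inj using 1
  ext z i
  simp only [splice]
  split_ifs <;> rfl

lemma measurePreserving_past_future (y : ℤ) :
    MeasurePreserving (fun ω : ℤ → X => (past ω y, future ω y)) (iidLaw ℤ ν)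
      ((iidLaw ℕ ν).prod (iidLaw ℕ ν)) := by
  let side : ℤ → ℕ ⊕ ℕ := fun x => if y ≤ x then .inr (x - y).toNat else .inl (y - 1 - x).toNat
  have h_inj : Function.Injective side := fun i j h => by grind
  have h_glue := measurePreserving_glue_iidLaw ν h_inj
  have h_meas : Measurable fun ω : ℤ → X => (past ω y, future ω y) := by fun_prop
  refine ⟨h_meas, ?_⟩
  rw [← h_glue.map_eq, Measure.map_map h_meas h_glue.measurable]
  convert Measure.map_id
  ext z i
  · simp [past, side, show ¬ y ≤ y - 1 - (i : ℤ) by omega]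
  · simp [future, side]

lemma measurePreserving_shift (m : ℤ) :
    MeasurePreserving (shift m) (iidLaw ℤ ν) (iidLaw ℤ ν) :=
  ⟨by unfold shift; fun_prop,
    Measure.map_infinitePi_infinitePi_of_inj (P := fun _ : ℤ => ν) (add_left_injective m)⟩

lemma lintegral_eq_tsum_fiber {Ω : Type*} [MeasurableSpace Ω] (P : Measure Ω) {τ : Ω → ℕ}
    (hτ : Measurable τ) (f : Ω → ℝ≥0∞) : ∫⁻ η, f η ∂P = ∑' m, ∫⁻ η in τ ⁻¹' {m}, f η ∂P := by
  rw [← lintegral_iUnion (fun m => hτ (measurableSet_singleton m)) fun m m' hm =>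
    (Set.disjoint_singleton.2 hm).preimage τ, ← Set.preimage_iUnion, Set.iUnion_of_singleton,
    Set.preimage_univ, setLIntegral_univ]

/-- The strong Markov property of an i.i.d. sequence: `hτ_stop` says that `τ` is a stopping time,
with `0` as the junk value of an index that does not exist. -/
theorem lintegral_dropSeq_stopping {τ : (ℕ → X) → ℕ} (hτ : Measurable τ)
    (hτ_stop : ∀ η η', 0 < τ η → (∀ i < τ η, η i = η' i) → τ η' = τ η)
    (hτ_pos : ∀ᵐ η ∂iidLaw ℕ ν, 0 < τ η) {F : (ℕ → X) → (ℕ → X) → ℝ≥0∞}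
    (hF : Measurable (Function.uncurry F))
    (hF_stop : ∀ η η', 0 < τ η → (∀ i < τ η, η i = η' i) → F η = F η') :
    ∫⁻ η, F η (dropSeq (τ η) η) ∂iidLaw ℕ ν = ∫⁻ η, ∫⁻ η', F η η' ∂iidLaw ℕ ν ∂iidLaw ℕ ν := by
  rw [lintegral_eq_tsum_fiber _ hτ, lintegral_eq_tsum_fiber _ hτ]
  refine tsum_congr fun m => ?_
  have h_fiber : MeasurableSet (τ ⁻¹' {m}) := hτ (measurableSet_singleton m)
  rcases m.eq_zero_or_pos with rfl | hm
  · have h_null : iidLaw ℕ ν (τ ⁻¹' {0}) = 0 := measure_mono_null (by grind) hτ_pos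
    simp [Measure.restrict_eq_zero.2 h_null]
  have h_agree : ∀ z : (ℕ → X) × (ℕ → X), ∀ i < m, z.1 i = splice m z i := fun z i hi =>
    (splice_of_lt hi z).symm
  have h_preimage : splice m ⁻¹' (τ ⁻¹' {m}) = (τ ⁻¹' {m}) ×ˢ Set.univ := by
    ext z
    have h₁ := hτ_stop z.1 (splice m z)
    have h₂ := hτ_stop (splice m z) z.1
    grind
  calc ∫⁻ η in τ ⁻¹' {m}, F η (dropSeq (τ η) η) ∂iidLaw ℕ ν
      = ∫⁻ η in τ ⁻¹' {m}, F η (dropSeq m η) ∂iidLaw ℕ ν :=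
        setLIntegral_congr_fun h_fiber fun η hη => by rw [show τ η = m from hη]
    _ = ∫⁻ z in (τ ⁻¹' {m}) ×ˢ Set.univ, F (splice m z) z.2 ∂(iidLaw ℕ ν).prod (iidLaw ℕ ν) := by
        have h_meas : Measurable fun η => F η (dropSeq m η) :=
          hF.comp (measurable_id.prodMk (measurable_dropSeq m))
        rw [← (measurePreserving_splice ν m).setLIntegral_comp_preimage h_fiber h_meas, h_preimage]
        simp only [dropSeq_splice]
    _ = ∫⁻ z in (τ ⁻¹' {m}) ×ˢ Set.univ, F z.1 z.2 ∂(iidLaw ℕ ν).prod (iidLaw ℕ ν) :=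
        setLIntegral_congr_fun (h_fiber.prod .univ) fun z hz => by
          obtain rfl : τ z.1 = m := hz.1
          simp only [hF_stop z.1 (splice (τ z.1) z) hm (h_agree z)]
    _ = ∫⁻ η in τ ⁻¹' {m}, ∫⁻ η', F η η' ∂iidLaw ℕ ν ∂iidLaw ℕ ν := by
        rw [← Measure.prod_restrict, Measure.restrict_univ]
        exact lintegral_prod _ hF.aemeasurable

end Iid

/-! ### First descents and ladder points -/

section Descent

variable {r r' : ℕ → ℝ≥0∞} {k m : ℕ}

/-- The first positive index at which the products of the ratios drop below `1`, and `0` if there is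
no such index. -/
def firstDescent (r : ℕ → ℝ≥0∞) : ℕ := sInf {k | 0 < k ∧ prefixProd r k < 1}

/-- The sequences all of whose products are less than `1`: a point of a two-sided sequence is a
ladder point if its past is of this kind. -/
def ladderPast : Set (ℕ → ℝ≥0∞) := {r | ∀ k, prefixProd r (k + 1) < 1}

lemma prefixProd_add (r : ℕ → ℝ≥0∞) (m k : ℕ) :
    prefixProd r (m + k) = prefixProd r m * prefixProd (dropSeq m r) k := by
  simp [prefixProd, Finset.prod_range_add, dropSeq]

lemma prefixProd_congr (h : ∀ i < k, r i = r' i) : prefixProd r k = prefixProd r' k :=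
  Finset.prod_congr rfl fun i hi => h i (Finset.mem_range.1 hi)

lemma affineRec_congr (w : ℝ≥0∞) (h : ∀ i < k, r i = r' i) :
    affineRec w r k = affineRec w r' k := by
  induction k with
  | zero => rfl
  | succ k ih => rw [affineRec, affineRec, ih fun i hi => h i (by omega), h k (by omega)]

lemma firstDescent_pos (hk : 0 < k) (h : prefixProd r k < 1) : 0 < firstDescent r :=
  (Nat.sInf_mem (s := {k | 0 < k ∧ prefixProd r k < 1}) ⟨k, hk, h⟩).1

lemma firstDescent_le (hk : 0 < k) (h : prefixProd r k < 1) : firstDescent r ≤ k :=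
  Nat.sInf_le ⟨hk, h⟩

lemma prefixProd_firstDescent_lt_one (h : 0 < firstDescent r) :
    prefixProd r (firstDescent r) < 1 :=
  (Nat.sInf_mem (Nat.nonempty_of_pos_sInf h)).2

lemma one_le_prefixProd (h : k < firstDescent r) : 1 ≤ prefixProd r k := by
  rcases k.eq_zero_or_pos with rfl | hk
  · simp
  · exact not_lt.1 fun hc => (firstDescent_le hk hc).not_gt h

lemma firstDescent_eq_iff (hm : 0 < m) :
    firstDescent r = m ↔ prefixProd r m < 1 ∧ ∀ k < m, 1 ≤ prefixProd r k := by
  constructor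
  · rintro rfl
    exact ⟨prefixProd_firstDescent_lt_one hm, fun k hk => one_le_prefixProd hk⟩
  · rintro ⟨h_lt, h_ge⟩
    refine (firstDescent_le hm h_lt).antisymm (not_lt.1 fun hc => (h_ge _ hc).not_gt ?_)
    exact prefixProd_firstDescent_lt_one (firstDescent_pos hm h_lt)

lemma firstDescent_congr (hr : 0 < firstDescent r) (h : ∀ i < firstDescent r, r i = r' i) :
    firstDescent r' = firstDescent r := by
  rw [firstDescent_eq_iff hr, ← prefixProd_congr h]
  refine ⟨prefixProd_firstDescent_lt_one hr, fun k hk => ?_⟩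
  rw [← prefixProd_congr fun i hi => h i (hi.trans hk)]
  exact one_le_prefixProd hk

@[fun_prop] lemma measurable_prefixProd (k : ℕ) : Measurable fun r => prefixProd r k := by
  unfold prefixProd; fun_prop

@[fun_prop] lemma measurable_perpetuity : Measurable perpetuity := by
  unfold perpetuity; exact .tsum fun k => by fun_prop

@[fun_prop] lemma measurable_affineRec (k : ℕ) :
    Measurable fun z : ℝ≥0∞ × (ℕ → ℝ≥0∞) => affineRec z.1 z.2 k := by
  induction k with
  | zero => exact measurable_fst
  | succ k ih => unfold affineRec; fun_prop

lemma measurableSet_ladderPast : MeasurableSet ladderPast := by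
  simp only [ladderPast, Set.ofPred_forall]
  exact .iInter fun k => measurableSet_lt (by fun_prop) (by fun_prop)

@[fun_prop] lemma measurable_firstDescent : Measurable firstDescent := by
  have h_fiber : ∀ m, 0 < m → MeasurableSet (firstDescent ⁻¹' {m}) := fun m hm => by
    have h_eq : firstDescent ⁻¹' {m} =
        {r | prefixProd r m < 1} ∩ ⋂ k ∈ Set.Iio m, {r | 1 ≤ prefixProd r k} := by
      ext r
      simp [firstDescent_eq_iff hm]
    rw [h_eq]
    exact (measurableSet_lt (by fun_prop) (by fun_prop)).inter
      (.biInter (Set.to_countable _) fun k _ => measurableSet_le (by fun_prop) (by fun_prop))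
  refine measurable_to_countable' fun m => ?_
  rcases m.eq_zero_or_pos with rfl | hm
  · have h_zero : firstDescent ⁻¹' {0} = ⋂ m : ℕ, (firstDescent ⁻¹' {m + 1})ᶜ := by
      ext r
      simp only [Set.mem_preimage, Set.mem_singleton_iff, Set.mem_iInter, Set.mem_compl_iff]
      exact ⟨fun h m => h ▸ m.succ_ne_zero.symm, fun h =>
        by_contra fun hc => h _ (Nat.succ_pred_eq_of_ne_zero hc).symm⟩
    rw [h_zero]
    exact .iInter fun m => (h_fiber _ m.succ_pos).compl
  · exact h_fiber m hm

/-- The sequence is cut at the last index where its products attain their maximum. -/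
lemma exists_dropSeq_mem_ladderPast (h : perpetuity r ≠ ∞) : ∃ k, dropSeq k r ∈ ladderPast := by
  have h_fin : {k | 1 ≤ prefixProd r k}.Finite := by
    refine ENNReal.finite_const_le_of_tsum_ne_top ?_ one_ne_zero
    rw [tsum_eq_zero_add' ENNReal.summable, prefixProd_zero]
    exact ENNReal.add_ne_top.2 ⟨ENNReal.one_ne_top, h⟩
  obtain ⟨k₀, hk₀, -⟩ := Set.exists_max_image _ (prefixProd r) h_fin ⟨0, by simp⟩
  obtain ⟨k, hk, h_last⟩ := Set.exists_max_image {k | prefixProd r k₀ ≤ prefixProd r k} id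
    (h_fin.subset fun _ => le_trans (Set.mem_ofPred.1 hk₀)) ⟨k₀, le_refl (prefixProd r k₀)⟩
  refine ⟨k, fun j => not_le.1 fun hj => ?_⟩
  have h_ge : prefixProd r k ≤ prefixProd r (k + (j + 1)) := by
    rw [prefixProd_add]
    exact le_mul_of_one_le_right' hj
  have h_le : k + (j + 1) ≤ k := h_last _ (le_trans hk h_ge)
  omega

end Descent

section Ladder

variable {X : Type*}

lemma dropSeq_past (ω : ℤ → X) (y : ℤ) (m : ℕ) : dropSeq m (past ω y) = past ω (y - m) := by
  ext i
  simp only [dropSeq, past]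
  congr 1
  omega

lemma dropSeq_future (ω : ℤ → X) (y : ℤ) (m : ℕ) : dropSeq m (future ω y) = future ω (y + m) := by
  ext i
  simp only [dropSeq, future]
  congr 1
  omega

lemma past_shift (ω : ℤ → X) (m y : ℤ) : past (shift m ω) y = past ω (y + m) := by
  ext i
  simp only [past, shift]
  congr 1
  omega

lemma future_shift (ω : ℤ → X) (m y : ℤ) : future (shift m ω) y = future ω (y + m) := by
  ext i
  simp only [future, shift]
  congr 1
  omega

variable {ρ : ℤ → ℝ≥0∞} {x : ℤ}

lemma prefixProd_past_add (ρ : ℤ → ℝ≥0∞) (x : ℤ) (m k : ℕ) :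
    prefixProd (past ρ (x + m)) (m + k) = prefixProd (future ρ x) m * prefixProd (past ρ x) k := by
  induction m with
  | zero => simp
  | succ m ih =>
    rw [Nat.cast_succ, ← add_assoc, Nat.add_right_comm, prefixProd_past_succ, ih,
      prefixProd_add _ m]
    simp only [dropSeq, future, prefixProd, Finset.prod_range_one, add_zero]
    ring

lemma prefixProd_past_eq_future (ρ : ℤ → ℝ≥0∞) (x : ℤ) (m : ℕ) :
    prefixProd (past ρ (x + m)) m = prefixProd (future ρ x) m := by
  simpa using prefixProd_past_add ρ x m 0

lemma mem_ladderPast_add_firstDescent (h : past ρ x ∈ ladderPast)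
    (hm : 0 < firstDescent (future ρ x)) :
    past ρ (x + firstDescent (future ρ x)) ∈ ladderPast := by
  set m := firstDescent (future ρ x)
  have h_lt : prefixProd (future ρ x) m < 1 := prefixProd_firstDescent_lt_one hm
  intro k
  rcases le_or_gt (k + 1) m with hk | hk
  · obtain ⟨j, hj⟩ := Nat.exists_eq_add_of_le' hk
    have h_split : prefixProd (future ρ x) m =
        prefixProd (future ρ x) j * prefixProd (past ρ (x + m)) (k + 1) := by
      rw [hj, prefixProd_add, dropSeq_future, Nat.cast_add, ← add_assoc, prefixProd_past_eq_future]
    calc prefixProd (past ρ (x + m)) (k + 1)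
        ≤ prefixProd (future ρ x) j * prefixProd (past ρ (x + m)) (k + 1) :=
          le_mul_of_one_le_left' (one_le_prefixProd (by omega))
      _ < 1 := h_split ▸ h_lt
  · obtain ⟨j, hj⟩ := Nat.exists_eq_add_of_lt hk
    rw [hj, add_assoc, prefixProd_past_add]
    exact (mul_le_of_le_one_right' (h j).le).trans_lt h_lt

lemma previous_ladder_unique {m m' : ℕ} (hm : 0 < m) (hm' : 0 < m')
    (h : past ρ (x - m) ∈ ladderPast ∧ firstDescent (future ρ (x - m)) = m)
    (h' : past ρ (x - m') ∈ ladderPast ∧ firstDescent (future ρ (x - m')) = m') : m = m' := by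
  wlog h_lt : m' < m generalizing m m'
  · rcases lt_trichotomy m' m with h_lt | h_eq | h_gt
    · exact this hm hm' h h' h_lt
    · exact h_eq.symm
    · exact (this hm' hm h' h h_gt).symm
  exfalso
  obtain ⟨j, hj⟩ := Nat.exists_eq_add_of_lt h_lt
  have h_prod : prefixProd (future ρ (x - m)) (j + 1) < 1 := by
    rw [← prefixProd_past_eq_future]
    convert h'.1 j using 3
    omega
  exact h_prod.not_ge (one_le_prefixProd (by omega))

lemma exists_previous_ladder (hx : past ρ x ∈ ladderPast)
    (h : ∃ m : ℕ, 0 < m ∧ past ρ (x - m) ∈ ladderPast) :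
    ∃ m : ℕ, 0 < m ∧ past ρ (x - m) ∈ ladderPast ∧ firstDescent (future ρ (x - m)) = m := by
  classical
  obtain ⟨hm, h_lad⟩ := Nat.find_spec h
  have h_min := fun k => Nat.find_min h (m := k)
  generalize Nat.find h = m at hm h_lad h_min
  have h_lt : prefixProd (future ρ (x - m)) m < 1 := by
    rw [← prefixProd_past_eq_future, sub_add_cancel]
    obtain ⟨j, rfl⟩ := Nat.exists_eq_succ_of_ne_zero hm.ne'
    exact hx j
  have h_pos := firstDescent_pos hm h_lt
  refine ⟨m, hm, h_lad, (firstDescent_le hm h_lt).antisymm (not_lt.1 fun hc => ?_)⟩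
  refine h_min _ (Nat.sub_lt hm h_pos) ⟨Nat.sub_pos_of_lt hc, ?_⟩
  convert mem_ladderPast_add_firstDescent h_lad h_pos using 2
  omega

end Ladder

section Subcritical

variable (ν : Measure ℝ≥0∞) [IsProbabilityMeasure ν]

lemma measurePreserving_past (y : ℤ) :
    MeasurePreserving (fun ρ : ℤ → ℝ≥0∞ => past ρ y) (iidLaw ℤ ν) (iidLaw ℕ ν) :=
  measurePreserving_fst.comp (measurePreserving_past_future ν y)

lemma measurePreserving_future (y : ℤ) :
    MeasurePreserving (fun ρ : ℤ → ℝ≥0∞ => future ρ y) (iidLaw ℤ ν) (iidLaw ℕ ν) :=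
  measurePreserving_snd.comp (measurePreserving_past_future ν y)

lemma lintegral_prefixProd (k : ℕ) : ∫⁻ r, prefixProd r k ∂iidLaw ℕ ν = (∫⁻ a, a ∂ν) ^ k := by
  induction k with
  | zero => simp
  | succ k ih =>
    have h_splice : ∀ z : (ℕ → ℝ≥0∞) × (ℕ → ℝ≥0∞),
        prefixProd (splice 1 z) (k + 1) = z.1 0 * prefixProd z.2 k := fun z => by
      rw [add_comm, prefixProd_add, dropSeq_splice]
      simp [prefixProd, splice]
    have h_head : ∫⁻ r : ℕ → ℝ≥0∞, r 0 ∂iidLaw ℕ ν = ∫⁻ a, a ∂ν :=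
      (measurePreserving_eval_iidLaw ν 0).lintegral_comp measurable_id
    rw [← (measurePreserving_splice ν 1).lintegral_comp (measurable_prefixProd _)]
    simp_rw [h_splice]
    rw [lintegral_prod_mul (f := fun r : ℕ → ℝ≥0∞ => r 0) (g := fun r => prefixProd r k)
      (measurable_pi_apply 0).aemeasurable (by fun_prop), h_head, ih, pow_succ']

variable {ν}

lemma lintegral_perpetuity_ne_top (hr : ∫⁻ a, a ∂ν < 1) : ∫⁻ r, perpetuity r ∂iidLaw ℕ ν ≠ ∞ := by
  unfold perpetuity
  rw [lintegral_tsum fun k => by fun_prop]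
  simp_rw [lintegral_prefixProd]
  rw [ENNReal.tsum_geometric_add_one]
  finiteness [(tsub_pos_of_lt hr).ne']

lemma ae_perpetuity_ne_top (hr : ∫⁻ a, a ∂ν < 1) : ∀ᵐ r ∂iidLaw ℕ ν, perpetuity r ≠ ∞ :=
  (ae_lt_top measurable_perpetuity (lintegral_perpetuity_ne_top hr)).mono fun _ h => h.ne

lemma ae_perpetuity_past_ne_top (hr : ∫⁻ a, a ∂ν < 1) :
    ∀ᵐ ρ ∂iidLaw ℤ ν, ∀ y, perpetuity (past ρ y) ≠ ∞ :=
  ae_all_iff.2 fun y =>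
    (measurePreserving_past ν y).quasiMeasurePreserving.ae (ae_perpetuity_ne_top hr)

lemma ae_firstDescent_pos (hr : ∫⁻ a, a ∂ν < 1) : ∀ᵐ r ∂iidLaw ℕ ν, 0 < firstDescent r := by
  filter_upwards [ae_perpetuity_ne_top hr] with r h_fin
  by_contra h_zero
  have h_ge : ∀ k, 1 ≤ prefixProd r (k + 1) := fun k =>
    not_lt.1 fun hk => h_zero (firstDescent_pos k.succ_pos hk)
  refine h_fin (top_le_iff.1 ?_)
  calc ∞ = ∑' _ : ℕ, (1 : ℝ≥0∞) := (ENNReal.tsum_const_eq_top_of_ne_zero one_ne_zero).symm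
    _ ≤ perpetuity r := ENNReal.tsum_le_tsum h_ge

lemma ae_exists_mem_ladderPast (hr : ∫⁻ a, a ∂ν < 1) :
    ∀ᵐ ρ ∂iidLaw ℤ ν, ∀ y, ∃ k : ℕ, past ρ (y - k) ∈ ladderPast := by
  filter_upwards [ae_perpetuity_past_ne_top hr] with ρ h_fin y
  simp only [← dropSeq_past]
  exact exists_dropSeq_mem_ladderPast (h_fin y)

lemma iidLaw_ladderPast_ne_zero (hr : ∫⁻ a, a ∂ν < 1) : iidLaw ℕ ν ladderPast ≠ 0 := by
  intro h_null
  have h_none : ∀ᵐ ρ ∂iidLaw ℤ ν, ∀ y, past ρ y ∉ ladderPast := ae_all_iff.2 fun y =>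
    (measurePreserving_past ν y).quasiMeasurePreserving.ae (measure_eq_zero_iff_ae_notMem.1 h_null)
  obtain ⟨ρ, h_ρ, h_ex⟩ := (h_none.and (ae_exists_mem_ladderPast hr)).exists
  obtain ⟨k, hk⟩ := h_ex 0
  exact h_ρ _ hk

end Subcritical

/-! ### Stationarity at the ladder points -/

section Stationarity

lemma measurable_apply_nat {α β : Type*} [MeasurableSpace α] [MeasurableSpace β] {f : ℕ → α → β}
    (hf : ∀ n, Measurable (f n)) {g : α → ℕ} (hg : Measurable g) : Measurable fun a => f (g a) a :=
  (measurable_from_prod_countable_right (f := fun p : ℕ × α => f p.1 p.2) hf).comp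
    (hg.prodMk measurable_id)

/-- The state of a two-sided sequence of ratios at `x`: the perpetuity of the past, which is all
that the crossing times need to know of the past, and the future. -/
def stateAt (ρ : ℤ → ℝ≥0∞) (x : ℤ) : ℝ≥0∞ × (ℕ → ℝ≥0∞) := (perpetuity (past ρ x), future ρ x)

/-- The passage from the state at a ladder point to the state at the next one. -/
def advance (z : ℝ≥0∞ × (ℕ → ℝ≥0∞)) : ℝ≥0∞ × (ℕ → ℝ≥0∞) :=
  (affineRec z.1 z.2 (firstDescent z.2), dropSeq (firstDescent z.2) z.2)

/-- The translation of a two-sided sequence that moves the first ladder point after `0` to `0`. -/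
def nextLadder (ρ : ℤ → ℝ≥0∞) : ℤ → ℝ≥0∞ := shift (firstDescent (future ρ 0)) ρ

/-- The law of the perpetuity of the past of a ladder point. -/
def perpetuityLaw (ν : Measure ℝ≥0∞) : Measure ℝ≥0∞ := (iidLaw ℕ ν)[|ladderPast].map perpetuity

/-- The law of the state at a ladder point. -/
def stateLaw (ν : Measure ℝ≥0∞) : Measure (ℝ≥0∞ × (ℕ → ℝ≥0∞)) := (perpetuityLaw ν).prod (iidLaw ℕ ν)

@[fun_prop] lemma measurable_advance : Measurable advance := by
  refine .prodMk ?_ ?_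
  · exact measurable_apply_nat measurable_affineRec (measurable_firstDescent.comp measurable_snd)
  · exact (measurable_apply_nat measurable_dropSeq measurable_firstDescent).comp measurable_snd

lemma advance_stateAt (ρ : ℤ → ℝ≥0∞) (x : ℤ) :
    advance (stateAt ρ x) = stateAt ρ (x + firstDescent (future ρ x)) := by
  simp only [advance, stateAt, affineRec_perpetuity_past, dropSeq_future]

lemma stateAt_nextLadder (ρ : ℤ → ℝ≥0∞) : stateAt (nextLadder ρ) 0 = advance (stateAt ρ 0) := by
  rw [advance_stateAt]
  simp only [stateAt, nextLadder, past_shift, future_shift]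

variable {ν : Measure ℝ≥0∞} [IsProbabilityMeasure ν]

lemma isProbabilityMeasure_perpetuityLaw (hr : ∫⁻ a, a ∂ν < 1) :
    IsProbabilityMeasure (perpetuityLaw ν) :=
  have := cond_isProbabilityMeasure (iidLaw_ladderPast_ne_zero hr)
  Measure.isProbabilityMeasure_map measurable_perpetuity.aemeasurable

/-- The event that `x` is a ladder point and the next ladder point is `x + m`. -/
def ladderBlock (x : ℤ) (m : ℕ) : Set (ℤ → ℝ≥0∞) :=
  {ρ | past ρ x ∈ ladderPast ∧ firstDescent (future ρ x) = m}

lemma measurableSet_ladderBlock (x : ℤ) (m : ℕ) : MeasurableSet (ladderBlock x m) :=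
  (measurable_past x measurableSet_ladderPast).inter
    (measurableSet_eq_fun (by fun_prop) measurable_const)

lemma preimage_shift_ladderBlock (m : ℕ) (S : Set (ℤ → ℝ≥0∞)) :
    shift m ⁻¹' (ladderBlock (-m) m ∩ S) = ladderBlock 0 m ∩ nextLadder ⁻¹' S := by
  ext ρ
  simp only [ladderBlock, Set.mem_preimage, Set.mem_inter_iff, Set.mem_ofPred_eq, past_shift,
    future_shift, neg_add_cancel, nextLadder]
  grind

lemma ae_iUnion_ladderBlock_start (hr : ∫⁻ a, a ∂ν < 1) :
    {ρ | past ρ 0 ∈ ladderPast} =ᵐ[iidLaw ℤ ν] ⋃ m : ℕ, ladderBlock 0 (m + 1) := by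
  filter_upwards [(measurePreserving_future ν 0).quasiMeasurePreserving.ae
    (ae_firstDescent_pos hr)] with ρ h_pos
  obtain ⟨m, hm⟩ := Nat.exists_eq_succ_of_ne_zero h_pos.ne'
  refine propext ⟨fun h => Set.mem_iUnion.2 ⟨m, h, hm⟩, fun h => ?_⟩
  obtain ⟨_, h_lad, _⟩ := Set.mem_iUnion.1 h
  exact h_lad

lemma ae_iUnion_ladderBlock_end (hr : ∫⁻ a, a ∂ν < 1) :
    {ρ | past ρ 0 ∈ ladderPast} =ᵐ[iidLaw ℤ ν]
      ⋃ m : ℕ, ladderBlock (-(m + 1 : ℕ)) (m + 1) := by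
  filter_upwards [ae_exists_mem_ladderPast hr] with ρ h_ex
  refine propext ⟨fun h_zero => ?_, fun h => ?_⟩
  · obtain ⟨k, hk⟩ := h_ex (-1)
    have h_prev : past ρ (0 - (k + 1 : ℕ)) ∈ ladderPast := by
      convert hk using 2
      omega
    obtain ⟨m, hm, h⟩ := exists_previous_ladder h_zero ⟨k + 1, k.succ_pos, h_prev⟩
    obtain ⟨m, rfl⟩ := Nat.exists_eq_succ_of_ne_zero hm.ne'
    rw [zero_sub] at h
    exact Set.mem_iUnion.2 ⟨m, h⟩
  · obtain ⟨m, h_lad, hm⟩ := Set.mem_iUnion.1 h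
    have h_next := mem_ladderPast_add_firstDescent h_lad (by omega)
    rwa [hm, neg_add_cancel] at h_next

/-- Both sides are sums, over the length of the block that separates the ladder point at `0` from
its neighbour on one side, of probabilities that differ by a translation. -/
lemma iidLaw_ladder_inter_preimage_nextLadder (hr : ∫⁻ a, a ∂ν < 1) {S : Set (ℤ → ℝ≥0∞)}
    (hS : MeasurableSet S) :
    iidLaw ℤ ν ({ρ | past ρ 0 ∈ ladderPast} ∩ nextLadder ⁻¹' S) =
      iidLaw ℤ ν ({ρ | past ρ 0 ∈ ladderPast} ∩ S) := by
  have h_end : ∀ m : ℕ, MeasurableSet (ladderBlock (-(m + 1 : ℕ)) (m + 1) ∩ S) := fun m =>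
    (measurableSet_ladderBlock _ _).inter hS
  have h_shift : ∀ m : ℕ, MeasurePreserving (shift m) (iidLaw ℤ ν) (iidLaw ℤ ν) :=
    fun m => measurePreserving_shift ν m
  have h_disjoint_start : Pairwise (Function.onFun Disjoint fun m : ℕ =>
      ladderBlock 0 (m + 1) ∩ nextLadder ⁻¹' S) := fun m m' hm => by
    refine Set.disjoint_left.2 fun ρ h h' => hm ?_
    have := h.1.2
    have := h'.1.2
    omega
  have h_disjoint_end : Pairwise (Function.onFun Disjoint fun m : ℕ =>
      ladderBlock (-(m + 1 : ℕ)) (m + 1) ∩ S) := fun m m' hm => by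
    refine Set.disjoint_left.2 fun ρ h h' => hm ?_
    have := previous_ladder_unique (x := 0) m.succ_pos m'.succ_pos
      (by rw [zero_sub]; exact h.1) (by rw [zero_sub]; exact h'.1)
    omega
  calc iidLaw ℤ ν ({ρ | past ρ 0 ∈ ladderPast} ∩ nextLadder ⁻¹' S)
      = iidLaw ℤ ν (⋃ m : ℕ, ladderBlock 0 (m + 1) ∩ nextLadder ⁻¹' S) := by
        rw [← Set.iUnion_inter]
        exact measure_congr ((ae_iUnion_ladderBlock_start hr).inter (ae_eq_refl _))
    _ = ∑' m : ℕ, iidLaw ℤ ν (shift (m + 1 : ℕ) ⁻¹' (ladderBlock (-(m + 1 : ℕ)) (m + 1) ∩ S)) := by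
        simp only [← preimage_shift_ladderBlock] at h_disjoint_start ⊢
        exact measure_iUnion h_disjoint_start fun m => (h_shift _).measurable (h_end m)
    _ = ∑' m : ℕ, iidLaw ℤ ν (ladderBlock (-(m + 1 : ℕ)) (m + 1) ∩ S) :=
        tsum_congr fun m => (h_shift _).measure_preimage (h_end m).nullMeasurableSet
    _ = iidLaw ℤ ν ({ρ | past ρ 0 ∈ ladderPast} ∩ S) := by
        rw [← measure_iUnion h_disjoint_end h_end, ← Set.iUnion_inter]
        exact measure_congr ((ae_iUnion_ladderBlock_end hr).symm.inter (ae_eq_refl _))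

/-- The law of an i.i.d. two-sided sequence of ratios, given that `0` is a ladder point. -/
def ladderPointLaw (ν : Measure ℝ≥0∞) : Measure (ℤ → ℝ≥0∞) :=
  (iidLaw ℤ ν)[|{ρ | past ρ 0 ∈ ladderPast}]

theorem measurePreserving_nextLadder (hr : ∫⁻ a, a ∂ν < 1) :
    MeasurePreserving nextLadder (ladderPointLaw ν) (ladderPointLaw ν) := by
  have h_meas : Measurable nextLadder := measurable_apply_nat
    (f := fun m ρ => shift m ρ) (fun m => by unfold shift; fun_prop)
    (g := fun ρ => firstDescent (future ρ 0)) (by fun_prop)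
  refine ⟨h_meas, Measure.ext fun S hS => ?_⟩
  have h_lad : MeasurableSet {ρ : ℤ → ℝ≥0∞ | past ρ 0 ∈ ladderPast} :=
    measurable_past 0 measurableSet_ladderPast
  rw [Measure.map_apply h_meas hS, ladderPointLaw, cond_apply h_lad, cond_apply h_lad,
    iidLaw_ladder_inter_preimage_nextLadder hr hS]

lemma measurePreserving_stateAt (hr : ∫⁻ a, a ∂ν < 1) :
    MeasurePreserving (fun ρ => stateAt ρ 0) (ladderPointLaw ν) (stateLaw ν) := by
  have := isProbabilityMeasure_perpetuityLaw hr
  have := cond_isProbabilityMeasure (iidLaw_ladderPast_ne_zero hr)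
  have h_split : MeasurePreserving (fun ρ : ℤ → ℝ≥0∞ => (past ρ 0, future ρ 0)) (ladderPointLaw ν)
      ((iidLaw ℕ ν)[|ladderPast].prod (iidLaw ℕ ν)) := by
    have h := ((measurePreserving_past_future ν 0).restrict_preimage
      (measurableSet_ladderPast.prod .univ)).smul_measure (iidLaw ℕ ν ladderPast)⁻¹
    have h_lad : iidLaw ℤ ν {ρ | past ρ 0 ∈ ladderPast} = iidLaw ℕ ν ladderPast :=
      (measurePreserving_past ν 0).measure_preimage measurableSet_ladderPast.nullMeasurableSet
    rw [← Measure.prod_restrict, Measure.restrict_univ, ← Measure.prod_smul_left,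
      Set.mk_preimage_prod, Set.preimage_univ, Set.inter_univ] at h
    rwa [ladderPointLaw, ProbabilityTheory.cond, ProbabilityTheory.cond, h_lad]
  have h_perp : MeasurePreserving perpetuity (iidLaw ℕ ν)[|ladderPast] (perpetuityLaw ν) :=
    ⟨measurable_perpetuity, rfl⟩
  exact (h_perp.prod (MeasurePreserving.id _)).comp h_split

theorem measurePreserving_advance (hr : ∫⁻ a, a ∂ν < 1) :
    MeasurePreserving advance (stateLaw ν) (stateLaw ν) :=
  (measurePreserving_stateAt hr).of_semiconj (measurePreserving_nextLadder hr) stateAt_nextLadder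
    measurable_advance

theorem lintegral_mul_advance (hr : ∫⁻ a, a ∂ν < 1) (w : ℝ≥0∞) {G : (ℕ → ℝ≥0∞) → ℝ≥0∞}
    (hG : Measurable G)
    (hG_stop : ∀ r r', 0 < firstDescent r → (∀ i < firstDescent r, r i = r' i) → G r = G r')
    {F : ℝ≥0∞ × (ℕ → ℝ≥0∞) → ℝ≥0∞} (hF : Measurable F) :
    ∫⁻ r, G r * F (advance (w, r)) ∂iidLaw ℕ ν =
      ∫⁻ r, G r * ∫⁻ r', F (affineRec w r (firstDescent r), r') ∂iidLaw ℕ ν ∂iidLaw ℕ ν := by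
  have h_meas : Measurable (Function.uncurry fun r r' : ℕ → ℝ≥0∞ =>
      G r * F (affineRec w r (firstDescent r), r')) := by
    have h_end : Measurable fun r => affineRec w r (firstDescent r) :=
      (measurable_advance.comp (measurable_const.prodMk measurable_id)).fst
    exact (hG.comp measurable_fst).mul
      (hF.comp ((h_end.comp measurable_fst).prodMk measurable_snd))
  refine (lintegral_dropSeq_stopping ν measurable_firstDescent (fun _ _ => firstDescent_congr)
    (ae_firstDescent_pos hr) h_meas fun r r' h_pos h => ?_).trans (lintegral_congr fun r => ?_)
  · simp only [firstDescent_congr h_pos h, affineRec_congr w h, hG_stop r r' h_pos h]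
  · exact lintegral_const_mul _ (by fun_prop)

end Stationarity

/-! ### Functionals of one block -/

section Block

variable {r r' : ℕ → ℝ≥0∞} {k : ℕ}

/-- The mean crossing time of the block of `z.2` up to its first descent, when `z.1` is the
perpetuity of the past at its start. -/
def blockCrossing (z : ℝ≥0∞ × (ℕ → ℝ≥0∞)) : ℝ≥0∞ :=
  ∑ j ∈ Finset.range (firstDescent z.2), (1 + 2 * affineRec z.1 z.2 (j + 1))

/-- The largest product of the ratios over an initial piece of the first block. -/
def blockHeight (r : ℕ → ℝ≥0∞) : ℝ≥0∞ := ⨆ j, ⨆ (_ : j < firstDescent r), prefixProd r (j + 1)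

/-- The coefficient of the perpetuity of the past in the affine function `blockCrossing (·, r)`. -/
def blockSlope (r : ℕ → ℝ≥0∞) : ℝ≥0∞ :=
  ∑ j ∈ Finset.range (firstDescent r), 2 * prefixProd r (j + 1)

/-- The contribution of the first block to the perpetuity of the past at its end. -/
def blockAccum (r : ℕ → ℝ≥0∞) : ℝ≥0∞ := affineRec 0 r (firstDescent r)

/-- The product of the ratios over the first block. -/
def blockProd (r : ℕ → ℝ≥0∞) : ℝ≥0∞ := prefixProd r (firstDescent r)

lemma affineRec_eq_add (w : ℝ≥0∞) (r : ℕ → ℝ≥0∞) (k : ℕ) :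
    affineRec w r k = affineRec 0 r k + prefixProd r k * w := by
  induction k with
  | zero => simp [affineRec]
  | succ k ih => rw [affineRec, affineRec, ih, prefixProd_succ]; ring

lemma affineRec_zero_le (hk : k ≤ firstDescent r) : affineRec 0 r k ≤ k * prefixProd r k := by
  induction k with
  | zero => simp [affineRec]
  | succ k ih =>
    calc affineRec 0 r (k + 1) ≤ r k * (prefixProd r k + k * prefixProd r k) := by
          rw [affineRec]
          gcongr
          exacts [one_le_prefixProd hk, ih (by omega)]
      _ = (k + 1 : ℕ) * prefixProd r (k + 1) := by rw [prefixProd_succ]; push_cast; ring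

lemma blockCrossing_eq_add (w : ℝ≥0∞) (r : ℕ → ℝ≥0∞) :
    blockCrossing (w, r) = blockCrossing (0, r) + blockSlope r * w := by
  simp only [blockCrossing, blockSlope, Finset.sum_mul, ← Finset.sum_add_distrib,
    affineRec_eq_add w]
  exact Finset.sum_congr rfl fun j _ => by ring

lemma affineRec_firstDescent (w : ℝ≥0∞) (r : ℕ → ℝ≥0∞) :
    affineRec w r (firstDescent r) = blockAccum r + blockProd r * w := affineRec_eq_add _ _ _

@[fun_prop] lemma measurable_blockCrossing : Measurable blockCrossing :=
  measurable_apply_nat (f := fun n (z : ℝ≥0∞ × (ℕ → ℝ≥0∞)) =>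
    ∑ j ∈ Finset.range n, (1 + 2 * affineRec z.1 z.2 (j + 1))) (fun n => by fun_prop)
    (measurable_firstDescent.comp measurable_snd)

@[fun_prop] lemma measurable_blockHeight : Measurable blockHeight :=
  measurable_apply_nat (f := fun n r => ⨆ j, ⨆ (_ : j < n), prefixProd r (j + 1))
    (fun n => .iSup fun j => .iSup fun _ => by fun_prop) measurable_firstDescent

@[fun_prop] lemma measurable_blockSlope : Measurable blockSlope :=
  measurable_apply_nat (f := fun n r => ∑ j ∈ Finset.range n, 2 * prefixProd r (j + 1))
    (fun n => by fun_prop) measurable_firstDescent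

@[fun_prop] lemma measurable_blockAccum : Measurable blockAccum :=
  (measurable_advance.comp (measurable_const.prodMk measurable_id)).fst

@[fun_prop] lemma measurable_blockProd : Measurable blockProd :=
  measurable_apply_nat measurable_prefixProd measurable_firstDescent

lemma blockProd_le_one (r : ℕ → ℝ≥0∞) : blockProd r ≤ 1 := by
  rcases (firstDescent r).eq_zero_or_pos with h | h
  · simp [blockProd, h]
  · exact (prefixProd_firstDescent_lt_one h).le

lemma blockAccum_le (r : ℕ → ℝ≥0∞) : blockAccum r ≤ firstDescent r :=
  (affineRec_zero_le le_rfl).trans (mul_le_of_le_one_right' (blockProd_le_one r))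

lemma prefixProd_le_blockHeight (hk : k < firstDescent r) :
    prefixProd r (k + 1) ≤ blockHeight r :=
  le_iSup₂_of_le (f := fun j (_ : j < firstDescent r) => prefixProd r (j + 1)) k hk le_rfl

lemma natCast_firstDescent_le (r : ℕ → ℝ≥0∞) :
    (firstDescent r : ℝ≥0∞) ≤ ∑' k, prefixProd r k :=
  calc (firstDescent r : ℝ≥0∞) = ∑ k ∈ Finset.range (firstDescent r), 1 := by simp
    _ ≤ ∑ k ∈ Finset.range (firstDescent r), prefixProd r k :=
      Finset.sum_le_sum fun k hk => one_le_prefixProd (Finset.mem_range.1 hk)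
    _ ≤ ∑' k, prefixProd r k := ENNReal.sum_le_tsum _

lemma blockSlope_le (r : ℕ → ℝ≥0∞) : blockSlope r ≤ 2 * perpetuity r := by
  rw [blockSlope, ← Finset.mul_sum, perpetuity]
  gcongr
  exact ENNReal.sum_le_tsum _

lemma blockCrossing_zero_le (r : ℕ → ℝ≥0∞) :
    blockCrossing (0, r) ≤
      ∑' k, prefixProd r k + 2 * ∑' k, ((k + 1 : ℕ) : ℝ≥0∞) * prefixProd r (k + 1) :=
  calc blockCrossing (0, r)
      = firstDescent r + 2 * ∑ j ∈ Finset.range (firstDescent r), affineRec 0 r (j + 1) := by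
        simp [blockCrossing, Finset.sum_add_distrib, Finset.mul_sum]
    _ ≤ ∑' k, prefixProd r k + 2 * ∑ j ∈ Finset.range (firstDescent r),
          ((j + 1 : ℕ) : ℝ≥0∞) * prefixProd r (j + 1) := by
        gcongr with j hj
        exacts [natCast_firstDescent_le r, affineRec_zero_le (Finset.mem_range.1 hj)]
    _ ≤ ∑' k, prefixProd r k + 2 * ∑' k, ((k + 1 : ℕ) : ℝ≥0∞) * prefixProd r (k + 1) := by
        gcongr
        exact ENNReal.sum_le_tsum _

lemma blockHeight_congr (hr : 0 < firstDescent r) (h : ∀ i < firstDescent r, r i = r' i) :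
    blockHeight r = blockHeight r' := by
  simp only [blockHeight, firstDescent_congr hr h]
  exact iSup_congr fun j => iSup_congr fun hj => prefixProd_congr fun i hi => h i (by omega)

lemma blockCrossing_congr (w : ℝ≥0∞) (hr : 0 < firstDescent r)
    (h : ∀ i < firstDescent r, r i = r' i) : blockCrossing (w, r) = blockCrossing (w, r') := by
  simp only [blockCrossing, firstDescent_congr hr h]
  refine Finset.sum_congr rfl fun j hj => ?_
  rw [affineRec_congr w fun i hi => h i (by grind)]

end Block

/-! ### Means over one block -/

section Mean

variable {ν : Measure ℝ≥0∞} [IsProbabilityMeasure ν]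

/-- The mean of the crossing time of a block. -/
def blockMean (ν : Measure ℝ≥0∞) : ℝ≥0∞ := ∫⁻ z, blockCrossing z ∂stateLaw ν

lemma lintegral_tsum_prefixProd_ne_top (hr : ∫⁻ a, a ∂ν < 1) :
    ∫⁻ r, ∑' k, prefixProd r k ∂iidLaw ℕ ν ≠ ∞ := by
  rw [lintegral_tsum fun k => by fun_prop]
  simp_rw [lintegral_prefixProd]
  rw [ENNReal.tsum_geometric]
  finiteness [(tsub_pos_of_lt hr).ne']

lemma lintegral_blockSlope_ne_top (hr : ∫⁻ a, a ∂ν < 1) : ∫⁻ r, blockSlope r ∂iidLaw ℕ ν ≠ ∞ := by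
  refine ne_top_of_le_ne_top ?_ (lintegral_mono blockSlope_le)
  rw [lintegral_const_mul _ measurable_perpetuity]
  finiteness [lintegral_perpetuity_ne_top hr]

lemma tsum_natCast_mul_pow_ne_top {a : ℝ≥0∞} (ha : a < 1) : ∑' k : ℕ, (k : ℝ≥0∞) * a ^ k ≠ ∞ := by
  lift a to NNReal using ha.ne_top
  have h_summable : Summable fun k : ℕ => (k : NNReal) * a ^ k := by
    rw [← NNReal.summable_coe]
    simpa using summable_pow_mul_geometric_of_norm_lt_one (R := ℝ) 1 (r := a)
      (by simpa using ha)
  exact_mod_cast ENNReal.tsum_coe_ne_top_iff_summable.2 h_summable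

lemma lintegral_blockCrossing_zero_ne_top (hr : ∫⁻ a, a ∂ν < 1) :
    ∫⁻ r, blockCrossing (0, r) ∂iidLaw ℕ ν ≠ ∞ := by
  refine ne_top_of_le_ne_top ?_ (lintegral_mono blockCrossing_zero_le)
  have h_meas : Measurable fun r => ∑' k, ((k + 1 : ℕ) : ℝ≥0∞) * prefixProd r (k + 1) :=
    Measurable.tsum fun k => by fun_prop
  have h_tail : ∫⁻ r, ∑' k, ((k + 1 : ℕ) : ℝ≥0∞) * prefixProd r (k + 1) ∂iidLaw ℕ ν ≠ ∞ := by
    rw [lintegral_tsum fun k => by fun_prop]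
    simp_rw [lintegral_const_mul _ (measurable_prefixProd _), lintegral_prefixProd]
    refine ne_top_of_le_ne_top (tsum_natCast_mul_pow_ne_top hr) ?_
    exact ENNReal.tsum_comp_le_tsum_of_injective (add_left_injective 1)
      fun k : ℕ => (k : ℝ≥0∞) * (∫⁻ a, a ∂ν) ^ k
  rw [lintegral_add_right _ (by fun_prop), lintegral_const_mul _ h_meas]
  finiteness [lintegral_tsum_prefixProd_ne_top hr]

lemma lintegral_blockProd_lt_one (hr : ∫⁻ a, a ∂ν < 1) : ∫⁻ r, blockProd r ∂iidLaw ℕ ν < 1 := by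
  have h_lt : ∫⁻ r, blockProd r ∂iidLaw ℕ ν < ∫⁻ _, 1 ∂iidLaw ℕ ν :=
    lintegral_strict_mono (IsProbabilityMeasure.ne_zero _) (by fun_prop)
      (ne_top_of_le_ne_top (by simp) (lintegral_mono blockProd_le_one))
      ((ae_firstDescent_pos hr).mono fun _ => prefixProd_firstDescent_lt_one)
  simpa using h_lt

lemma lintegral_perpetuityLaw_ne_top (hr : ∫⁻ a, a ∂ν < 1) : ∫⁻ w, w ∂perpetuityLaw ν ≠ ∞ := by
  rw [perpetuityLaw, lintegral_map (f := fun w => w) measurable_id measurable_perpetuity,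
    ProbabilityTheory.cond, lintegral_smul_measure]
  exact ENNReal.mul_ne_top (ENNReal.inv_ne_top.2 (iidLaw_ladderPast_ne_zero hr))
    (ne_top_of_le_ne_top (lintegral_perpetuity_ne_top hr) (setLIntegral_le_lintegral _ _))

lemma lintegral_stateLaw_affine (hr : ∫⁻ a, a ∂ν < 1) {f g : (ℕ → ℝ≥0∞) → ℝ≥0∞}
    (hf : Measurable f) (hg : Measurable g) :
    ∫⁻ z, (f z.2 + g z.2 * z.1) ∂stateLaw ν =
      ∫⁻ r, f r ∂iidLaw ℕ ν + (∫⁻ r, g r ∂iidLaw ℕ ν) * ∫⁻ w, w ∂perpetuityLaw ν := by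
  have := isProbabilityMeasure_perpetuityLaw hr
  have h_fst : ∫⁻ z, f z.2 ∂stateLaw ν = ∫⁻ r, f r ∂iidLaw ℕ ν :=
    measurePreserving_snd.lintegral_comp hf
  rw [lintegral_add_left (by fun_prop), h_fst, mul_comm]
  simp_rw [mul_comm (g _)]
  congr 1
  exact lintegral_prod_mul (f := fun w => w) measurable_id.aemeasurable hg.aemeasurable

lemma lintegral_perpetuityLaw_eq (hr : ∫⁻ a, a ∂ν < 1) :
    ∫⁻ w, w ∂perpetuityLaw ν = ∫⁻ r, blockAccum r ∂iidLaw ℕ ν +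
      (∫⁻ r, blockProd r ∂iidLaw ℕ ν) * ∫⁻ w, w ∂perpetuityLaw ν := by
  have := isProbabilityMeasure_perpetuityLaw hr
  calc ∫⁻ w, w ∂perpetuityLaw ν = ∫⁻ z, z.1 ∂stateLaw ν :=
        (measurePreserving_fst.lintegral_comp measurable_id).symm
    _ = ∫⁻ z, (advance z).1 ∂stateLaw ν :=
        ((measurePreserving_advance hr).lintegral_comp measurable_fst).symm
    _ = ∫⁻ z, (blockAccum z.2 + blockProd z.2 * z.1) ∂stateLaw ν :=
        lintegral_congr fun z => affineRec_firstDescent z.1 z.2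
    _ = _ := lintegral_stateLaw_affine hr measurable_blockAccum measurable_blockProd

lemma blockMean_eq (hr : ∫⁻ a, a ∂ν < 1) :
    blockMean ν = ∫⁻ r, blockCrossing (0, r) ∂iidLaw ℕ ν +
      (∫⁻ r, blockSlope r ∂iidLaw ℕ ν) * ∫⁻ w, w ∂perpetuityLaw ν :=
  calc blockMean ν = ∫⁻ z, (blockCrossing (0, z.2) + blockSlope z.2 * z.1) ∂stateLaw ν :=
        lintegral_congr fun z => blockCrossing_eq_add z.1 z.2
    _ = _ := lintegral_stateLaw_affine hr (f := fun r => blockCrossing (0, r)) (by fun_prop)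
        measurable_blockSlope

lemma blockMean_ne_top (hr : ∫⁻ a, a ∂ν < 1) : blockMean ν ≠ ∞ := by
  rw [blockMean_eq hr]
  finiteness [lintegral_blockCrossing_zero_ne_top hr, lintegral_blockSlope_ne_top hr,
    lintegral_perpetuityLaw_ne_top hr]

end Mean

/-! ### Exponential moments -/

section Exponential

/-- The exponential function on `[0, ∞]`. -/
def eexp (x : ℝ≥0∞) : ℝ≥0∞ := EReal.exp x

lemma eexp_coe (x : ℝ≥0) : eexp x = ENNReal.ofReal (Real.exp x) := rfl

@[simp] lemma eexp_zero : eexp 0 = 1 := by simp [eexp]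

lemma eexp_add (x y : ℝ≥0∞) : eexp (x + y) = eexp x * eexp y := by
  simp only [eexp, EReal.coe_ennreal_add, EReal.exp_add]

lemma eexp_ne_top {x : ℝ≥0∞} (hx : x ≠ ∞) : eexp x ≠ ∞ := by
  lift x to ℝ≥0 using hx
  exact ENNReal.ofReal_ne_top

lemma one_add_le_eexp (x : ℝ≥0∞) : 1 + x ≤ eexp x := by
  induction x with
  | top => simp [eexp]
  | coe x =>
    calc (1 + x : ℝ≥0∞) = ENNReal.ofReal ((x : ℝ) + 1) := by
          rw [ENNReal.ofReal_add x.coe_nonneg zero_le_one, ENNReal.ofReal_coe_nnreal,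
            ENNReal.ofReal_one, add_comm]
      _ ≤ eexp x := ENNReal.ofReal_le_ofReal (Real.add_one_le_exp _)

lemma eexp_ne_zero (x : ℝ≥0∞) : eexp x ≠ 0 :=
  (lt_of_lt_of_le one_pos (le_self_add.trans (one_add_le_eexp x))).ne'

lemma eexp_sum {ι : Type*} (s : Finset ι) (f : ι → ℝ≥0∞) :
    eexp (∑ i ∈ s, f i) = ∏ i ∈ s, eexp (f i) := by
  induction s using Finset.cons_induction with
  | empty => simp
  | cons i s hi ih => rw [Finset.sum_cons, Finset.prod_cons, eexp_add, ih]

@[gcongr] lemma eexp_le_eexp {x y : ℝ≥0∞} (h : x ≤ y) : eexp x ≤ eexp y :=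
  EReal.exp_monotone (EReal.coe_ennreal_le_coe_ennreal_iff.2 h)

@[fun_prop] lemma measurable_eexp : Measurable eexp :=
  EReal.measurable_exp.comp measurable_coe_ennreal_ereal

lemma eexp_le_one_add {x : ℝ≥0∞} {δ : ℝ≥0} (hδ : δ ≤ 1) (hx : x ≤ δ) :
    eexp x ≤ 1 + (1 + δ) * x := by
  lift x to ℝ≥0 using ne_top_of_le_ne_top ENNReal.coe_ne_top hx
  have hx' : (x : ℝ) ≤ δ := by exact_mod_cast hx
  have h_exp : Real.exp x ≤ 1 + (1 + δ) * x := by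
    have h_le_one : |(x : ℝ)| ≤ 1 := by
      rw [NNReal.abs_eq]
      exact hx'.trans (by exact_mod_cast hδ)
    have h_taylor := (abs_le.1 (Real.abs_exp_sub_one_sub_id_le h_le_one)).2
    nlinarith [x.2]
  calc eexp x ≤ ENNReal.ofReal ((1 + (1 + δ) * x : ℝ≥0) : ℝ) :=
        ENNReal.ofReal_le_ofReal (by exact_mod_cast h_exp)
    _ = 1 + (1 + δ) * x := by rw [ENNReal.ofReal_coe_nnreal]; push_cast; rfl

variable {E : Type*} [MeasurableSpace E] {P : Measure E}

lemma lintegral_indicator_eexp_le [IsProbabilityMeasure P] {u : E → ℝ≥0∞} (hu : Measurable u)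
    {G : Set E} {δ : ℝ≥0} (hδ : δ ≤ 1) (h : ∀ z ∈ G, u z ≤ δ) :
    ∫⁻ z, G.indicator (fun z => eexp (u z)) z ∂P ≤ eexp ((1 + δ) * ∫⁻ z, u z ∂P) :=
  calc ∫⁻ z, G.indicator (fun z => eexp (u z)) z ∂P ≤ ∫⁻ z, (1 + (1 + δ) * u z) ∂P :=
        lintegral_mono (Set.indicator_le fun z hz => eexp_le_one_add hδ (h z hz))
    _ = 1 + (1 + δ) * ∫⁻ z, u z ∂P := by
        rw [lintegral_add_left measurable_const, lintegral_const_mul _ hu, lintegral_one,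
          measure_univ]
    _ ≤ eexp ((1 + δ) * ∫⁻ z, u z ∂P) := one_add_le_eexp _

theorem measure_le_sum_iterate_le {T : E → E} (hT : MeasurePreserving T P P) {f : E → ℝ≥0∞}
    (hf : Measurable f) {G : Set E} (hG : MeasurableSet G) (t : ℝ≥0) (N : ℕ) :
    P {z | t ≤ ∑ i ∈ Finset.range N, f (T^[i] z)} ≤ N * P Gᶜ +
      (∫⁻ z, ∏ i ∈ Finset.range N, G.indicator (fun z => eexp (f z)) (T^[i] z) ∂P) / eexp t := by
  set W : E → ℝ≥0∞ := fun z =>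
    ∏ i ∈ Finset.range N, G.indicator (fun z => eexp (f z)) (T^[i] z)
  have h_iter : ∀ i, MeasurePreserving T^[i] P P := hT.iterate
  have h_meas : Measurable W := Finset.measurable_prod _ fun i _ =>
    ((measurable_eexp.comp hf).indicator hG).comp (h_iter i).measurable
  have h_sub : {z | t ≤ ∑ i ∈ Finset.range N, f (T^[i] z)} ⊆
      (⋃ i ∈ Finset.range N, T^[i] ⁻¹' Gᶜ) ∪ {z | eexp t ≤ W z} := by
    intro z hz
    by_cases h_good : ∀ i ∈ Finset.range N, T^[i] z ∈ G
    · refine .inr ((eexp_le_eexp hz).trans_eq ?_)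
      rw [eexp_sum]
      exact Finset.prod_congr rfl fun i hi =>
        (Set.indicator_of_mem (h_good i hi) fun z => eexp (f z)).symm
    · push Not at h_good
      obtain ⟨i, hi, h_bad⟩ := h_good
      exact .inl (Set.mem_biUnion hi h_bad)
  refine (measure_mono h_sub).trans ((measure_union_le _ _).trans (add_le_add ?_ ?_))
  · calc P (⋃ i ∈ Finset.range N, T^[i] ⁻¹' Gᶜ) ≤ ∑ i ∈ Finset.range N, P (T^[i] ⁻¹' Gᶜ) :=
          measure_biUnion_finset_le _ _
      _ = N * P Gᶜ := by
          simp only [(h_iter _).measure_preimage hG.compl.nullMeasurableSet, Finset.sum_const,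
            Finset.card_range, nsmul_eq_mul]
  · exact meas_ge_le_lintegral_div h_meas.aemeasurable (eexp_ne_zero _)
      (eexp_ne_top ENNReal.coe_ne_top)

end Exponential

/-! ### Moderate blocks -/

section Moderate

variable {ν : Measure ℝ≥0∞} [IsProbabilityMeasure ν]

lemma iidLaw_lt_firstDescent_le (ν : Measure ℝ≥0∞) [IsProbabilityMeasure ν] (h : ℕ) :
    iidLaw ℕ ν {r | h < firstDescent r} ≤ (∫⁻ a, a ∂ν) ^ h :=
  calc iidLaw ℕ ν {r | h < firstDescent r} ≤ iidLaw ℕ ν {r | 1 ≤ prefixProd r h} :=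
        measure_mono fun _ => one_le_prefixProd
    _ ≤ ∫⁻ r, prefixProd r h ∂iidLaw ℕ ν := by
        simpa using mul_meas_ge_le_lintegral (μ := iidLaw ℕ ν) (measurable_prefixProd h) 1
    _ = (∫⁻ a, a ∂ν) ^ h := lintegral_prefixProd ν h

lemma perpetuity_le_of_mem_ladderPast {r : ℕ → ℝ≥0∞} (hr : r ∈ ladderPast) (h : ℕ) :
    perpetuity r ≤ h + ∑' k, prefixProd r (k + h + 1) :=
  calc perpetuity r
      = ∑ k ∈ Finset.range h, prefixProd r (k + 1) + ∑' k, prefixProd r (k + h + 1) :=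
        (ENNReal.summable.sum_add_tsum_nat_add' (f := fun k => prefixProd r (k + 1))).symm
    _ ≤ ∑ k ∈ Finset.range h, 1 + ∑' k, prefixProd r (k + h + 1) := by
        gcongr with k
        exact (hr k).le
    _ = h + ∑' k, prefixProd r (k + h + 1) := by simp

lemma lintegral_tsum_prefixProd_add (ν : Measure ℝ≥0∞) [IsProbabilityMeasure ν] (h : ℕ) :
    ∫⁻ r, ∑' k, prefixProd r (k + h + 1) ∂iidLaw ℕ ν =
      (∫⁻ r, perpetuity r ∂iidLaw ℕ ν) * (∫⁻ a, a ∂ν) ^ h := by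
  unfold perpetuity
  rw [lintegral_tsum fun k => by fun_prop, lintegral_tsum fun k => by fun_prop,
    ← ENNReal.tsum_mul_right]
  simp_rw [lintegral_prefixProd, ← pow_add, add_right_comm]

lemma perpetuityLaw_lt_le (ν : Measure ℝ≥0∞) [IsProbabilityMeasure ν] {h : ℕ} (hh : 0 < h) :
    perpetuityLaw ν (Set.Ioi (2 * h)) ≤
      (iidLaw ℕ ν ladderPast)⁻¹ * (∫⁻ r, perpetuity r ∂iidLaw ℕ ν) * (∫⁻ a, a ∂ν) ^ h := by
  have h_meas : Measurable fun r => ∑' k, prefixProd r (k + h + 1) :=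
    Measurable.tsum fun k => by fun_prop
  have h_sub : ladderPast ∩ perpetuity ⁻¹' Set.Ioi (2 * h) ⊆
      {r | 1 ≤ ∑' k, prefixProd r (k + h + 1)} := by
    rintro r ⟨h_past, h_lt⟩
    have h_add : (h : ℝ≥0∞) + h < h + ∑' k, prefixProd r (k + h + 1) := by
      rw [← two_mul]
      exact lt_of_lt_of_le h_lt (perpetuity_le_of_mem_ladderPast h_past h)
    have h_one_le : (1 : ℝ≥0∞) ≤ h := by exact_mod_cast hh
    exact h_one_le.trans (lt_of_add_lt_add_left h_add).le
  rw [perpetuityLaw, Measure.map_apply measurable_perpetuity measurableSet_Ioi,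
    cond_apply measurableSet_ladderPast, mul_assoc]
  gcongr
  calc iidLaw ℕ ν (ladderPast ∩ perpetuity ⁻¹' Set.Ioi (2 * h))
      ≤ iidLaw ℕ ν {r | 1 ≤ ∑' k, prefixProd r (k + h + 1)} := measure_mono h_sub
    _ ≤ ∫⁻ r, ∑' k, prefixProd r (k + h + 1) ∂iidLaw ℕ ν := by
        simpa using mul_meas_ge_le_lintegral (μ := iidLaw ℕ ν) h_meas 1
    _ = _ := lintegral_tsum_prefixProd_add ν h

/-- The states that are moderate at scale `h`: the perpetuity of the past is at most `2 * h` and the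
next block is not longer than `h`. -/
def moderate (h : ℕ) : Set (ℝ≥0∞ × (ℕ → ℝ≥0∞)) :=
  Set.Iic (2 * h : ℝ≥0∞) ×ˢ {r | firstDescent r ≤ h}

lemma measurableSet_firstDescent_le (h : ℕ) : MeasurableSet {r | firstDescent r ≤ h} :=
  measurableSet_le measurable_firstDescent measurable_const

lemma measurableSet_moderate (h : ℕ) : MeasurableSet (moderate h) :=
  measurableSet_Iic.prod (measurableSet_firstDescent_le h)

lemma stateLaw_compl_moderate_le (hr : ∫⁻ a, a ∂ν < 1) {h : ℕ} (hh : 0 < h) :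
    stateLaw ν (moderate h)ᶜ ≤
      ((iidLaw ℕ ν ladderPast)⁻¹ * (∫⁻ r, perpetuity r ∂iidLaw ℕ ν) + 1) *
        (∫⁻ a, a ∂ν) ^ h := by
  have := isProbabilityMeasure_perpetuityLaw hr
  rw [add_mul, one_mul]
  calc stateLaw ν (moderate h)ᶜ
      ≤ perpetuityLaw ν (Set.Iic (2 * h : ℝ≥0∞))ᶜ + iidLaw ℕ ν {r | firstDescent r ≤ h}ᶜ := by
        rw [moderate, Set.compl_prod_eq_union, stateLaw]
        refine (measure_union_le _ _).trans_eq ?_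
        simp only [Measure.prod_prod, measure_univ, mul_one, one_mul]
    _ = perpetuityLaw ν (Set.Ioi (2 * h)) + iidLaw ℕ ν {r | h < firstDescent r} := by
        simp only [Set.compl_Iic, Set.compl_ofPred, not_le]
    _ ≤ _ := add_le_add (perpetuityLaw_lt_le ν hh) (iidLaw_lt_firstDescent_le ν h)

/-- The crossing time of the next block, set to `0` if the block is higher than `b`. -/
def truncCrossing (b : ℝ≥0∞) (z : ℝ≥0∞ × (ℕ → ℝ≥0∞)) : ℝ≥0∞ :=
  {z' : ℝ≥0∞ × (ℕ → ℝ≥0∞) | blockHeight z'.2 ≤ b}.indicator blockCrossing z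

@[fun_prop] lemma measurable_truncCrossing (b : ℝ≥0∞) : Measurable (truncCrossing b) :=
  measurable_blockCrossing.indicator (measurableSet_le (by fun_prop) measurable_const)

lemma truncCrossing_le (b : ℝ≥0∞) (z : ℝ≥0∞ × (ℕ → ℝ≥0∞)) : truncCrossing b z ≤ blockCrossing z :=
  Set.indicator_le_self _ _ z

lemma truncCrossing_congr (b w : ℝ≥0∞) {r r' : ℕ → ℝ≥0∞} (hr : 0 < firstDescent r)
    (h : ∀ i < firstDescent r, r i = r' i) : truncCrossing b (w, r) = truncCrossing b (w, r') := by
  simp only [truncCrossing, Set.indicator, Set.mem_ofPred_eq, blockHeight_congr hr h,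
    blockCrossing_congr w hr h]
  congr

variable {b w : ℝ≥0∞} {r : ℕ → ℝ≥0∞} {h : ℕ}

lemma truncCrossing_le_of_mem_moderate (hb : 1 ≤ b) (hh : 0 < h) (hz : (w, r) ∈ moderate h) :
    truncCrossing b (w, r) ≤ 7 * (h * h * b) := by
  have hh' : (1 : ℝ≥0∞) ≤ h := by exact_mod_cast hh
  have h_sum : blockHeight r ≤ b → blockCrossing (w, r) ≤
      ∑ j ∈ Finset.range (firstDescent r), (1 + 2 * (h * b + b * (2 * h))) := fun h_height => by
    refine Finset.sum_le_sum fun j hj => ?_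
    have hj' : j < firstDescent r := Finset.mem_range.1 hj
    have h_prod : prefixProd r (j + 1) ≤ b := (prefixProd_le_blockHeight hj').trans h_height
    have h_len : ((j + 1 : ℕ) : ℝ≥0∞) ≤ h := by exact_mod_cast (Nat.succ_le_of_lt hj').trans hz.2
    rw [affineRec_eq_add]
    gcongr
    exacts [(affineRec_zero_le hj').trans (by gcongr), hz.1]
  refine Set.indicator_apply_le' (fun h_height => (h_sum h_height).trans ?_) fun _ => zero_le
  calc ∑ j ∈ Finset.range (firstDescent r), (1 + 2 * (h * b + b * (2 * h)))
      = firstDescent r * (1 + 2 * (h * b + b * (2 * h))) := by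
        rw [Finset.sum_const, Finset.card_range, nsmul_eq_mul]
    _ ≤ h * (h * b + 2 * (h * b + b * (2 * h))) := by
        gcongr
        exacts [hz.2, one_le_mul hh' hb]
    _ = 7 * (h * h * b) := by ring

lemma affineRec_firstDescent_le_of_mem_moderate (hz : (w, r) ∈ moderate h) :
    affineRec w r (firstDescent r) ≤ 3 * h :=
  calc affineRec w r (firstDescent r) = blockAccum r + blockProd r * w :=
        affineRec_firstDescent w r
    _ ≤ h + 1 * (2 * h) := by
        gcongr
        exacts [(blockAccum_le r).trans (by exact_mod_cast hz.2), blockProd_le_one r, hz.1]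
    _ = 3 * h := by ring

end Moderate

/-! ### The exponential bound -/

section Drift

variable {ν : Measure ℝ≥0∞} {δ c κ l : ℝ≥0} {b : ℝ≥0∞} {h : ℕ}

/-- The drift condition behind the exponential bound: with a relative margin `δ`, the mean crossing
time of a block plus `c` times the mean perpetuity at its end is at most `κ` plus `c` times the
perpetuity at its start. -/
structure HasDrift (ν : Measure ℝ≥0∞) (δ c κ : ℝ≥0) : Prop where
  pos : 0 < δ
  le_one : δ ≤ 1
  slope_le : (1 + δ : ℝ≥0∞) *
    (∫⁻ r, blockSlope r ∂iidLaw ℕ ν + c * ∫⁻ r, blockProd r ∂iidLaw ℕ ν) ≤ c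
  intercept_le : (1 + δ : ℝ≥0∞) *
    (∫⁻ r, blockCrossing (0, r) ∂iidLaw ℕ ν + c * ∫⁻ r, blockAccum r ∂iidLaw ℕ ν) ≤ κ

lemma lintegral_truncCrossing_add_le (hd : HasDrift ν δ c κ) (b w : ℝ≥0∞) (l : ℝ≥0) :
    (1 + δ) * ∫⁻ r, l * (truncCrossing b (w, r) + c * (advance (w, r)).1) ∂iidLaw ℕ ν ≤
      l * (κ + c * w) := by
  have h_split : ∀ r, l * (truncCrossing b (w, r) + c * (advance (w, r)).1) ≤
      l * ((blockCrossing (0, r) + c * blockAccum r) + (blockSlope r + c * blockProd r) * w) :=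
    fun r =>
    calc l * (truncCrossing b (w, r) + c * (advance (w, r)).1)
        ≤ l * (blockCrossing (w, r) + c * affineRec w r (firstDescent r)) := by
          gcongr
          exacts [truncCrossing_le b _, le_rfl]
      _ = _ := by rw [blockCrossing_eq_add, affineRec_firstDescent]; ring
  calc (1 + δ) * ∫⁻ r, l * (truncCrossing b (w, r) + c * (advance (w, r)).1) ∂iidLaw ℕ ν
      ≤ (1 + δ) * ∫⁻ r, l * ((blockCrossing (0, r) + c * blockAccum r) +
          (blockSlope r + c * blockProd r) * w) ∂iidLaw ℕ ν := by
        gcongr _ * ?_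
        exact lintegral_mono h_split
    _ = l * ((1 + δ) * (∫⁻ r, blockCrossing (0, r) ∂iidLaw ℕ ν +
            c * ∫⁻ r, blockAccum r ∂iidLaw ℕ ν) +
          (1 + δ) * (∫⁻ r, blockSlope r ∂iidLaw ℕ ν +
            c * ∫⁻ r, blockProd r ∂iidLaw ℕ ν) * w) := by
        rw [lintegral_const_mul _ (by fun_prop), lintegral_add_left (by fun_prop),
          lintegral_mul_const _ (by fun_prop), lintegral_add_left (by fun_prop),
          lintegral_add_left (by fun_prop), lintegral_const_mul _ (by fun_prop),
          lintegral_const_mul _ (by fun_prop)]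
        ring
    _ ≤ l * (κ + c * w) := by
        gcongr
        exacts [hd.intercept_le, hd.slope_le]

lemma exists_one_add_mul_le {a b c d : ℝ≥0} (hab : a < b) (hcd : c < d) :
    ∃ δ : ℝ≥0, 0 < δ ∧ δ ≤ 1 ∧ (1 + δ) * a ≤ b ∧ (1 + δ) * c ≤ d := by
  have h_ev : ∀ {a b : ℝ≥0}, a < b → ∀ᶠ δ : ℝ≥0 in 𝓝 0, (1 + δ) * a < b := fun {a b} hab =>
    Filter.Tendsto.eventually_lt_const hab <|
      (show Continuous fun δ : ℝ≥0 => (1 + δ) * a by fun_prop).tendsto' 0 a (by simp)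
  obtain ⟨δ, ⟨⟨h_ab, h_cd⟩, h_one⟩, h_pos⟩ :=
    ((((h_ev hab).and (h_ev hcd)).and (Iic_mem_nhds zero_lt_one)).filter_mono
      nhdsWithin_le_nhds |>.and (self_mem_nhdsWithin (s := Set.Ioi 0))).exists
  exact ⟨δ, h_pos, h_one, h_ab.le, h_cd.le⟩

/-- Any `c` above `y / (1 - p)` contracts the perpetuity, and at `c = y / (1 - p)` the intercept
`x + c * s` is the stationary mean `x + y * W`. -/
lemma exists_contraction {x y s p W κ : ℝ≥0} (hp : p < 1) (hW : W = s + p * W)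
    (hκ : x + y * W < κ) : ∃ c, y + c * p < c ∧ x + c * s < κ := by
  obtain ⟨q, hq, hpq⟩ := exists_pos_add_of_lt' hp
  have hs : s = q * W := add_right_cancel (b := p * W) <| by
    rw [← hW, ← add_mul, add_comm, hpq, one_mul]
  have h_base : x + y / q * s < κ := by
    rwa [hs, ← mul_assoc, div_mul_cancel₀ _ hq.ne']
  have h_ev : ∀ᶠ c : ℝ≥0 in 𝓝 (y / q), x + c * s < κ :=
    (show Continuous fun c : ℝ≥0 => x + c * s by fun_prop).continuousAt.eventually_lt_const h_base
  obtain ⟨c, h_int, hc⟩ := ((h_ev.filter_mono nhdsWithin_le_nhds).and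
    (self_mem_nhdsWithin (s := Set.Ioi (y / q)))).exists
  refine ⟨c, ?_, h_int⟩
  calc y + c * p < c * q + c * p := add_lt_add_left ((div_lt_iff₀ hq).1 hc) _
    _ = c := by rw [← mul_add, add_comm, hpq, mul_one]

lemma exists_contraction_margin {x y s p W : ℝ≥0∞} (hy : y ≠ ∞) (hp : p < 1) (hW_top : W ≠ ∞)
    (hW : W = s + p * W) (hκ : x + y * W < κ) :
    ∃ δ c : ℝ≥0, 0 < δ ∧ δ ≤ 1 ∧ (1 + δ) * (y + c * p) ≤ c ∧ (1 + δ) * (x + c * s) ≤ κ := by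
  have hs : s ≠ ∞ := ne_top_of_le_ne_top hW_top (le_self_add.trans_eq hW.symm)
  lift x to ℝ≥0 using ne_top_of_le_ne_top hκ.ne_top le_self_add
  lift y to ℝ≥0 using hy
  lift s to ℝ≥0 using hs
  lift p to ℝ≥0 using hp.ne_top
  lift W to ℝ≥0 using hW_top
  obtain ⟨c, h_slope, h_int⟩ := exists_contraction (x := x) (y := y) (κ := κ)
    (by exact_mod_cast hp) (by exact_mod_cast hW) (by exact_mod_cast hκ)
  obtain ⟨δ, h_pos, h_one, h_slope', h_int'⟩ := exists_one_add_mul_le h_slope h_int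
  exact ⟨δ, c, h_pos, h_one, by exact_mod_cast h_slope', by exact_mod_cast h_int'⟩

variable [IsProbabilityMeasure ν]

lemma exists_hasDrift (hr : ∫⁻ a, a ∂ν < 1) (hκ : blockMean ν < κ) :
    ∃ δ c, HasDrift ν δ c κ := by
  rw [blockMean_eq hr] at hκ
  obtain ⟨δ, c, h_pos, h_one, h_slope, h_int⟩ := exists_contraction_margin
    (lintegral_blockSlope_ne_top hr) (lintegral_blockProd_lt_one hr)
    (lintegral_perpetuityLaw_ne_top hr) (lintegral_perpetuityLaw_eq hr) hκ
  exact ⟨δ, c, h_pos, h_one, h_slope, h_int⟩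

lemma lintegral_moderate_eexp_le (hd : HasDrift ν δ c κ) (hb : 1 ≤ b) (hh : 0 < h)
    (hl : l * ((7 + 3 * c) * (h * h * b)) ≤ δ) (w : ℝ≥0∞) :
    ∫⁻ r, (moderate h).indicator
        (fun z => eexp (l * (truncCrossing b z + c * (advance z).1))) (w, r) ∂iidLaw ℕ ν ≤
      eexp (l * (κ + c * w)) := by
  have hh' : (1 : ℝ≥0∞) ≤ h := by exact_mod_cast hh
  have h_small : ∀ r ∈ {r | (w, r) ∈ moderate h},
      l * (truncCrossing b (w, r) + c * (advance (w, r)).1) ≤ δ := fun r hr =>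
    calc l * (truncCrossing b (w, r) + c * (advance (w, r)).1)
        ≤ l * (7 * (h * h * b) + c * (3 * (h * h * b))) := by
          gcongr
          · exact truncCrossing_le_of_mem_moderate hb hh hr
          · refine (affineRec_firstDescent_le_of_mem_moderate hr).trans ?_
            gcongr
            exact (le_mul_of_one_le_right' hh').trans (le_mul_of_one_le_right' hb)
      _ = l * ((7 + 3 * c) * (h * h * b)) := by ring
      _ ≤ δ := hl
  have h_meas : Measurable fun r => l * (truncCrossing b (w, r) + c * (advance (w, r)).1) :=
    (((measurable_truncCrossing b).comp measurable_prodMk_left).add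
      ((measurable_advance.comp measurable_prodMk_left).fst.const_mul _)).const_mul _
  exact (lintegral_indicator_eexp_le (P := iidLaw ℕ ν) h_meas hd.le_one h_small).trans
    (eexp_le_eexp (lintegral_truncCrossing_add_le hd b w l))

end Drift

section ExponentialBound

variable {ν : Measure ℝ≥0∞} [IsProbabilityMeasure ν] {δ c κ l : ℝ≥0} {b : ℝ≥0∞} {h : ℕ}

/-- The exponential of the truncated crossing time of one block, restricted to the states that are
moderate at scale `h`. -/
def tiltedCrossing (h : ℕ) (b : ℝ≥0∞) (l : ℝ≥0) : ℝ≥0∞ × (ℕ → ℝ≥0∞) → ℝ≥0∞ :=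
  (moderate h).indicator fun z => eexp (l * truncCrossing b z)

@[fun_prop] lemma measurable_tiltedCrossing (h : ℕ) (b : ℝ≥0∞) (l : ℝ≥0) :
    Measurable (tiltedCrossing h b l) :=
  Measurable.indicator (by fun_prop) (measurableSet_moderate h)

lemma measurable_prod_tiltedCrossing (h : ℕ) (b : ℝ≥0∞) (l : ℝ≥0) (N : ℕ) :
    Measurable fun z => ∏ i ∈ Finset.range N, tiltedCrossing h b l (advance^[i] z) :=
  Finset.measurable_prod _ fun i _ =>
    (measurable_tiltedCrossing h b l).comp (measurable_advance.iterate i)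

lemma tiltedCrossing_congr (w : ℝ≥0∞) {r r' : ℕ → ℝ≥0∞} (hr : 0 < firstDescent r)
    (heq : ∀ i < firstDescent r, r i = r' i) :
    tiltedCrossing h b l (w, r) = tiltedCrossing h b l (w, r') := by
  simp only [tiltedCrossing, moderate, Set.indicator, Set.mem_prod, Set.mem_ofPred_eq,
    truncCrossing_congr b w hr heq, firstDescent_congr hr heq]

lemma tiltedCrossing_mul_eexp (z : ℝ≥0∞ × (ℕ → ℝ≥0∞)) :
    tiltedCrossing h b l z * eexp (l * (c * (advance z).1)) =
      (moderate h).indicator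
        (fun z => eexp (l * (truncCrossing b z + c * (advance z).1))) z := by
  simp only [tiltedCrossing, Set.indicator, mul_add, eexp_add, ite_mul, zero_mul]

lemma lintegral_prod_tiltedCrossing_le (hr : ∫⁻ a, a ∂ν < 1) (hd : HasDrift ν δ c κ) (hb : 1 ≤ b)
    (hh : 0 < h) (hl : l * ((7 + 3 * c) * (h * h * b)) ≤ δ) (N : ℕ) (w : ℝ≥0∞) :
    ∫⁻ r, ∏ i ∈ Finset.range N, tiltedCrossing h b l (advance^[i] (w, r)) ∂iidLaw ℕ ν ≤
      eexp (l * (N * κ + c * w)) := by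
  induction N generalizing w with
  | zero => simpa using le_self_add.trans (one_add_le_eexp (l * (c * w)))
  | succ N ih =>
    have h_meas : Measurable fun r => tiltedCrossing h b l (w, r) := by fun_prop
    calc ∫⁻ r, ∏ i ∈ Finset.range (N + 1), tiltedCrossing h b l (advance^[i] (w, r)) ∂iidLaw ℕ ν
        = ∫⁻ r, tiltedCrossing h b l (w, r) *
            ∏ i ∈ Finset.range N, tiltedCrossing h b l (advance^[i] (advance (w, r)))
              ∂iidLaw ℕ ν := by
          simp only [Finset.prod_range_succ', Function.iterate_succ_apply,
            Function.iterate_zero_apply, mul_comm]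
      _ = ∫⁻ r, tiltedCrossing h b l (w, r) * ∫⁻ r', ∏ i ∈ Finset.range N,
            tiltedCrossing h b l (advance^[i] (affineRec w r (firstDescent r), r'))
              ∂iidLaw ℕ ν ∂iidLaw ℕ ν :=
          lintegral_mul_advance hr w h_meas (fun _ _ => tiltedCrossing_congr w)
            (measurable_prod_tiltedCrossing h b l N)
      _ ≤ ∫⁻ r, eexp (l * (N * κ)) * (tiltedCrossing h b l (w, r) *
            eexp (l * (c * (advance (w, r)).1))) ∂iidLaw ℕ ν := by
          refine lintegral_mono fun r => ?_
          rw [mul_left_comm, ← eexp_add, ← mul_add]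
          gcongr
          exact ih _
      _ ≤ eexp (l * (N * κ)) * eexp (l * (κ + c * w)) := by
          simp_rw [tiltedCrossing_mul_eexp]
          rw [lintegral_const_mul' _ _ (eexp_ne_top (by finiteness))]
          gcongr
          exact lintegral_moderate_eexp_le hd hb hh hl w
      _ = eexp (l * ((N + 1 : ℕ) * κ + c * w)) := by
          rw [← eexp_add]
          push_cast
          ring_nf

lemma lintegral_stateLaw_prod_tiltedCrossing_le (hr : ∫⁻ a, a ∂ν < 1) (hd : HasDrift ν δ c κ)
    (hb : 1 ≤ b) (hh : 0 < h) (hl : l * ((7 + 3 * c) * (h * h * b)) ≤ δ) {N : ℕ} (hN : N ≠ 0) :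
    ∫⁻ z, ∏ i ∈ Finset.range N, tiltedCrossing h b l (advance^[i] z) ∂stateLaw ν ≤
      eexp (l * (N * κ + c * (2 * h))) := by
  have := isProbabilityMeasure_perpetuityLaw hr
  have h_fiber : ∀ w, ∫⁻ r, ∏ i ∈ Finset.range N, tiltedCrossing h b l (advance^[i] (w, r))
      ∂iidLaw ℕ ν ≤ eexp (l * (N * κ + c * (2 * h))) := fun w => by
    rcases le_or_gt w (2 * h) with hw | hw
    · refine (lintegral_prod_tiltedCrossing_le hr hd hb hh hl N w).trans ?_
      gcongr
    · have h_zero : ∀ r, tiltedCrossing h b l (w, r) = 0 := fun r =>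
        Set.indicator_of_notMem (fun hz => hw.not_ge hz.1) _
      have h_prod : ∀ r, ∏ i ∈ Finset.range N, tiltedCrossing h b l (advance^[i] (w, r)) = 0 :=
        fun r => Finset.prod_eq_zero (Finset.mem_range.2 (Nat.pos_of_ne_zero hN)) (h_zero r)
      simp [h_prod]
  rw [stateLaw, lintegral_prod _ (measurable_prod_tiltedCrossing h b l N).aemeasurable]
  exact (lintegral_mono h_fiber).trans (by simp)

lemma stateLaw_le_sum_truncCrossing_le (hr : ∫⁻ a, a ∂ν < 1) (hd : HasDrift ν δ c κ)
    {b : ℝ≥0} (hb : 1 ≤ b) (hh : 0 < h) (hl : l * ((7 + 3 * c) * (h * h * b)) ≤ δ) {N : ℕ}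
    (hN : N ≠ 0) (γ : ℝ≥0) :
    stateLaw ν {z | N * (κ + γ) ≤ ∑ i ∈ Finset.range N, truncCrossing b (advance^[i] z)} ≤
      N * stateLaw ν (moderate h)ᶜ + eexp 1 / eexp (l * (N * γ)) := by
  have := isProbabilityMeasure_perpetuityLaw hr
  have h_one : l * (c * (2 * h)) ≤ 1 := by
    have hh' : (1 : ℝ≥0) ≤ h := by exact_mod_cast hh
    calc l * (c * (2 * h)) = l * (2 * c * h) := by ring
      _ ≤ l * ((7 + 3 * c) * (h * h * b)) := by
          gcongr
          · exact le_add_of_nonneg_of_le zero_le (by gcongr; norm_num)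
          · exact (le_mul_of_one_le_right' hh').trans (le_mul_of_one_le_right' hb)
      _ ≤ 1 := hl.trans hd.le_one
  have h_sub : {z | N * (κ + γ) ≤ ∑ i ∈ Finset.range N, truncCrossing b (advance^[i] z)} ⊆
      {z | ((l * (N * (κ + γ)) : ℝ≥0) : ℝ≥0∞) ≤
        ∑ i ∈ Finset.range N, l * truncCrossing b (advance^[i] z)} := fun z hz => by
    rw [Set.mem_ofPred_eq, ← Finset.mul_sum]
    push_cast
    gcongr
    exact hz
  calc stateLaw ν {z | N * (κ + γ) ≤ ∑ i ∈ Finset.range N, truncCrossing b (advance^[i] z)}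
      ≤ N * stateLaw ν (moderate h)ᶜ + (∫⁻ z, ∏ i ∈ Finset.range N,
          tiltedCrossing h b l (advance^[i] z) ∂stateLaw ν) / eexp ↑(l * (N * (κ + γ))) :=
        (measure_mono h_sub).trans (measure_le_sum_iterate_le (measurePreserving_advance hr)
          (by fun_prop) (measurableSet_moderate h) _ N)
    _ ≤ N * stateLaw ν (moderate h)ᶜ +
          eexp (l * (N * κ)) * eexp (l * (c * (2 * h))) / eexp ↑(l * (N * (κ + γ))) := by
        rw [← eexp_add, ← mul_add]
        gcongr
        exact lintegral_stateLaw_prod_tiltedCrossing_le hr hd (by exact_mod_cast hb) hh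
          (by exact_mod_cast hl) hN
    _ = N * stateLaw ν (moderate h)ᶜ + eexp (l * (c * (2 * h))) / eexp (l * (N * γ)) := by
        push_cast
        rw [mul_add (N : ℝ≥0∞), mul_add (l : ℝ≥0∞), eexp_add,
          ENNReal.mul_div_mul_left _ _ (eexp_ne_zero _) (eexp_ne_top (by finiteness))]
    _ ≤ _ := by
        gcongr
        exact_mod_cast h_one

theorem exists_stateLaw_le_sum_truncCrossing_le (hr : ∫⁻ a, a ∂ν < 1) (hκ : blockMean ν < κ) :
    ∃ θ : ℝ≥0, 0 < θ ∧ ∃ A : ℝ≥0∞, A ≠ ∞ ∧ ∀ b : ℝ≥0, 1 ≤ b → ∀ h N : ℕ, 0 < h → N ≠ 0 →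
      stateLaw ν {z | N * κ ≤ ∑ i ∈ Finset.range N, truncCrossing b (advance^[i] z)} ≤
        A * (N * (∫⁻ a, a ∂ν) ^ h + (eexp ↑(θ / (h * h * b) * N))⁻¹) := by
  obtain ⟨κ₀, h_mean, h_lt⟩ := ENNReal.lt_iff_exists_nnreal_btwn.1 hκ
  obtain ⟨γ, hγ, rfl⟩ := exists_pos_add_of_lt' (ENNReal.coe_lt_coe.1 h_lt)
  obtain ⟨δ, c, hd⟩ := exists_hasDrift hr h_mean
  set A := (iidLaw ℕ ν ladderPast)⁻¹ * (∫⁻ r, perpetuity r ∂iidLaw ℕ ν) + 1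
  have hA : A ≠ ∞ := by
    finiteness [iidLaw_ladderPast_ne_zero hr, lintegral_perpetuity_ne_top hr]
  refine ⟨δ / (7 + 3 * c) * γ, by have := hd.pos; positivity, A + eexp 1,
    ENNReal.add_ne_top.2 ⟨hA, eexp_ne_top ENNReal.one_ne_top⟩, fun b hb h N hh hN => ?_⟩
  have := one_pos.trans_le hb
  have hl : δ / (7 + 3 * c) / (h * h * b) * ((7 + 3 * c) * (h * h * b)) ≤ δ := by
    rw [div_div, div_mul_cancel₀ _ (by positivity)]
  have h_rate : δ / (7 + 3 * c) * γ / (h * h * b) * N =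
      δ / (7 + 3 * c) / (h * h * b) * (N * γ) := by ring
  calc stateLaw ν {z | N * ((κ₀ + γ : ℝ≥0) : ℝ≥0∞) ≤
        ∑ i ∈ Finset.range N, truncCrossing b (advance^[i] z)}
      ≤ N * stateLaw ν (moderate h)ᶜ +
          eexp 1 / eexp ↑(δ / (7 + 3 * c) * γ / (h * h * b) * N) := by
        rw [h_rate]
        exact_mod_cast stateLaw_le_sum_truncCrossing_le hr hd hb hh hl hN γ
    _ ≤ N * (A * (∫⁻ a, a ∂ν) ^ h) +
          eexp 1 * (eexp ↑(δ / (7 + 3 * c) * γ / (h * h * b) * N))⁻¹ := by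
        rw [div_eq_mul_inv]
        gcongr
        exact stateLaw_compl_moderate_le hr hh
    _ ≤ _ := by
        rw [mul_add, mul_left_comm]
        gcongr
        exacts [le_self_add, le_add_self]

end ExponentialBound

/-! ### Ladder points and crossing times of an environment -/

section Environment

lemma rhoProd_eq_past (ω : Env) (y : ℤ) (k : ℕ) :
    rhoProd ω (y - k) (y - 1) = prefixProd (past (rho ω) y) k := by
  refine Finset.prod_nbij' (fun z => (y - 1 - z).toNat) (fun i => y - 1 - i) ?_ ?_ ?_ ?_ ?_
  all_goals simp only [Finset.mem_Icc, Finset.mem_range, past]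
  iterate 4 omega
  · intro z hz
    congr 1
    omega

lemma rhoProd_eq_future (ω : Env) (x : ℤ) (k : ℕ) :
    rhoProd ω x (x + k - 1) = prefixProd (future (rho ω) x) k := by
  rw [← prefixProd_past_eq_future, ← rhoProd_eq_past, add_sub_cancel_right]

lemma forall_rhoProd_lt_one_iff (ω : Env) (y : ℤ) :
    (∀ k < y, rhoProd ω k (y - 1) < 1) ↔ past (rho ω) y ∈ ladderPast := by
  refine ⟨fun h k => ?_, fun h k hk => ?_⟩
  · rw [← rhoProd_eq_past]
    exact h _ (by omega)
  · have h_lt := h (y - 1 - k).toNat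
    rwa [← rhoProd_eq_past, show y - ((y - 1 - k).toNat + 1 : ℕ) = k by omega] at h_lt

variable {ω : Env} {n : ℕ}

lemma ladder_zero_eq_zero_iff (hW : perpetuity (past (rho ω) 0) ≠ ∞) :
    ladder ω 0 = 0 ↔ past (rho ω) 0 ∈ ladderPast := by
  change sSup {y : ℤ | y ≤ 0 ∧ ∀ k < y, rhoProd ω k (y - 1) < 1} = 0 ↔ _
  simp only [forall_rhoProd_lt_one_iff]
  refine ⟨fun h => ?_, fun h => IsGreatest.csSup_eq ⟨⟨le_rfl, h⟩, fun y hy => hy.1⟩⟩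
  obtain ⟨k, hk⟩ := exists_dropSeq_mem_ladderPast hW
  rw [dropSeq_past] at hk
  have h_mem := Int.csSup_mem (s := {y : ℤ | y ≤ 0 ∧ past (rho ω) y ∈ ladderPast})
    ⟨0 - k, by omega, hk⟩ ⟨0, fun y hy => hy.1⟩
  exact (h ▸ h_mem).2

lemma ladderPos_succ (h : 0 < firstDescent (future (rho ω) (ladderPos ω n))) :
    ladderPos ω (n + 1) = ladderPos ω n + firstDescent (future (rho ω) (ladderPos ω n)) := by
  rw [ladderPos]
  refine IsLeast.csInf_eq ⟨⟨by omega, ?_⟩, fun z ⟨hz, hz_lt⟩ => ?_⟩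
  · rw [rhoProd_eq_future]
    exact prefixProd_firstDescent_lt_one h
  · obtain ⟨k, rfl⟩ := Int.le.dest hz.le
    rw [rhoProd_eq_future] at hz_lt
    have := firstDescent_le (by omega) hz_lt
    omega

lemma advance_iterate_stateAt (h_zero : ladder ω 0 = 0)
    (h_pos : ∀ i, 0 < firstDescent (advance^[i] (stateAt (rho ω) 0)).2) (n : ℕ) :
    advance^[n] (stateAt (rho ω) 0) = stateAt (rho ω) (ladderPos ω n) := by
  induction n with
  | zero => rw [Function.iterate_zero_apply, show ladderPos ω 0 = 0 from h_zero]
  | succ n ih =>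
    have h := h_pos n
    rw [ih] at h
    rw [Function.iterate_succ_apply', ih, advance_stateAt, ladderPos_succ h]

lemma height_eq_blockHeight (h : 0 < firstDescent (future (rho ω) (ladderPos ω n))) :
    height ω n = blockHeight (future (rho ω) (ladderPos ω n)) := by
  change ⨆ j ∈ Set.Ico (ladderPos ω n) (ladderPos ω (n + 1)), rhoProd ω (ladderPos ω n) j = _
  rw [ladderPos_succ h, blockHeight]
  set x := ladderPos ω n
  have h_prod : ∀ k : ℕ, rhoProd ω x (x + k) = prefixProd (future (rho ω) x) (k + 1) := fun k => by
    rw [← rhoProd_eq_future, show x + (k + 1 : ℕ) - 1 = x + k by omega]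
  refine le_antisymm (iSup₂_le fun j ⟨hxj, hj⟩ => ?_) (iSup₂_le fun k hk => ?_)
  · obtain ⟨k, rfl⟩ := Int.le.dest hxj
    rw [h_prod]
    exact le_iSup₂ (f := fun k (_ : k < firstDescent (future (rho ω) x)) =>
      prefixProd (future (rho ω) x) (k + 1)) k (by omega)
  · rw [← h_prod]
    exact le_iSup₂ (f := fun j (_ : j ∈ Set.Ico x (x + firstDescent (future (rho ω) x))) =>
      rhoProd ω x j) (x + k) ⟨by omega, by omega⟩

variable (hω : ∀ x, 0 < (ω x : ℝ)) (hW : ∀ x, perpetuity (past (rho ω) x) ≠ ∞)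
  (h : 0 < firstDescent (future (rho ω) (ladderPos ω n)))
include hω hW h

lemma crossing_eq_blockCrossing :
    crossing ω n = blockCrossing (stateAt (rho ω) (ladderPos ω n)) := by
  change ∫⁻ X, hitTime (ladderPos ω (n + 1)) X ∂quenchedLaw ω (ladderPos ω n) = _
  rw [ladderPos_succ h, lintegral_hitTime_quenchedLaw hω hW]
  rfl

lemma smallCrossing_eq_truncCrossing (b : ℝ) :
    smallCrossing b ω n = truncCrossing (ENNReal.ofReal b) (stateAt (rho ω) (ladderPos ω n)) := by
  simp only [smallCrossing, truncCrossing, Set.indicator, Set.mem_ofPred_eq,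
    height_eq_blockHeight h, crossing_eq_blockCrossing hω hW h, stateAt]
  congr

end Environment

section LadderLaw

@[fun_prop] lemma measurable_odds : Measurable odds := by unfold odds; fun_prop

variable {μ : Measure (Set.Icc (0 : ℝ) 1)}

lemma lintegral_map_odds : ∫⁻ a, a ∂μ.map odds = ∫⁻ p, odds p ∂μ :=
  lintegral_map measurable_id measurable_odds

variable [IsProbabilityMeasure μ]

instance : IsProbabilityMeasure (μ.map odds) :=
  Measure.isProbabilityMeasure_map measurable_odds.aemeasurable

lemma measurePreserving_rho : MeasurePreserving rho (envLaw μ) (iidLaw ℤ (μ.map odds)) :=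
  measurePreserving_comp_iidLaw μ ℤ measurable_odds

variable (hr : ∫⁻ p, odds p ∂μ < 1)
include hr

lemma ae_envLaw_pos : ∀ᵐ ω ∂envLaw μ, ∀ x, 0 < (ω x : ℝ) := by
  have h_pos : ∀ᵐ (p : Set.Icc (0 : ℝ) 1) ∂μ, 0 < (p : ℝ) := by
    filter_upwards [ae_lt_top measurable_odds hr.ne_top] with p hp
    refine lt_of_le_of_ne p.2.1 fun h_zero => hp.ne ?_
    simp [odds, ← h_zero]
  exact ae_all_iff.2 fun x => (measurePreserving_eval_iidLaw μ x).quasiMeasurePreserving.ae h_pos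

lemma ae_envLaw_perpetuity_past_ne_top :
    ∀ᵐ ω ∂envLaw μ, ∀ x, perpetuity (past (rho ω) x) ≠ ∞ :=
  measurePreserving_rho.quasiMeasurePreserving.ae
    (ae_perpetuity_past_ne_top (by rwa [lintegral_map_odds]))

lemma ladder_zero_ae_eq :
    ({ω | ladder ω 0 = 0} : Set Env) =ᵐ[envLaw μ] rho ⁻¹' {ρ | past ρ 0 ∈ ladderPast} := by
  filter_upwards [ae_envLaw_perpetuity_past_ne_top hr] with ω hω
  exact propext (ladder_zero_eq_zero_iff (hω 0))

lemma envLaw_ladder_zero : envLaw μ {ω | ladder ω 0 = 0} = iidLaw ℕ (μ.map odds) ladderPast := by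
  rw [measure_congr (ladder_zero_ae_eq hr)]
  exact ((measurePreserving_past _ 0).comp measurePreserving_rho).measure_preimage
    measurableSet_ladderPast.nullMeasurableSet

lemma envLaw_ladder_zero_ne_zero : envLaw μ {ω | ladder ω 0 = 0} ≠ 0 := by
  rw [envLaw_ladder_zero hr]
  exact iidLaw_ladderPast_ne_zero (by rwa [lintegral_map_odds])

lemma ladderLaw_eq :
    ladderLaw μ = (envLaw μ)[|rho ⁻¹' {ρ | past ρ 0 ∈ ladderPast}] := by
  rw [ladderLaw, ProbabilityTheory.cond, ProbabilityTheory.cond,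
    measure_congr (ladder_zero_ae_eq hr), Measure.restrict_congr_set (ladder_zero_ae_eq hr)]

lemma measurePreserving_rho_ladderLaw :
    MeasurePreserving rho (ladderLaw μ) (ladderPointLaw (μ.map odds)) := by
  have h_lad : MeasurableSet {ρ : ℤ → ℝ≥0∞ | past ρ 0 ∈ ladderPast} :=
    measurable_past 0 measurableSet_ladderPast
  have h := (measurePreserving_rho (μ := μ)).restrict_preimage h_lad |>.smul_measure
    (iidLaw ℤ (μ.map odds) {ρ | past ρ 0 ∈ ladderPast})⁻¹
  rwa [← measurePreserving_rho.measure_preimage h_lad.nullMeasurableSet,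
    ← ProbabilityTheory.cond, ← ladderLaw_eq hr,
    measurePreserving_rho.measure_preimage h_lad.nullMeasurableSet] at h

lemma measurePreserving_stateAt_rho :
    MeasurePreserving (fun ω => stateAt (rho ω) 0) (ladderLaw μ) (stateLaw (μ.map odds)) :=
  (measurePreserving_stateAt (by rwa [lintegral_map_odds])).comp
    (measurePreserving_rho_ladderLaw hr)

lemma ae_ladderLaw_ladder_zero : ∀ᵐ ω ∂ladderLaw μ, ladder ω 0 = 0 := by
  have h_lad : MeasurableSet (rho ⁻¹' {ρ | past ρ 0 ∈ ladderPast}) :=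
    (measurePreserving_rho (μ := μ)).measurable (measurable_past 0 measurableSet_ladderPast)
  have h_mem : ∀ᵐ ω ∂ladderLaw μ, past (rho ω) 0 ∈ ladderPast := by
    rw [ladderLaw_eq hr]
    exact ae_cond_mem h_lad
  filter_upwards [h_mem, cond_absolutelyContinuous.ae_le (ae_envLaw_perpetuity_past_ne_top hr)]
    with ω h hW using (ladder_zero_eq_zero_iff (hW 0)).2 h

lemma ae_ladderLaw_firstDescent_pos :
    ∀ᵐ ω ∂ladderLaw μ, ∀ i, 0 < firstDescent (advance^[i] (stateAt (rho ω) 0)).2 := by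
  have hr' : ∫⁻ a, a ∂μ.map odds < 1 := by rwa [lintegral_map_odds]
  have := isProbabilityMeasure_perpetuityLaw hr'
  have h_snd : ∀ᵐ z ∂stateLaw (μ.map odds), 0 < firstDescent z.2 :=
    (measurePreserving_snd (μ := perpetuityLaw (μ.map odds))
      (ν := iidLaw ℕ (μ.map odds))).quasiMeasurePreserving.ae (ae_firstDescent_pos hr')
  exact ae_all_iff.2 fun i => (((measurePreserving_advance hr').iterate i).comp
    (measurePreserving_stateAt_rho hr)).quasiMeasurePreserving.ae h_snd

lemma ae_ladderLaw_crossing_eq :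
    ∀ᵐ ω ∂ladderLaw μ, ∀ n : ℕ,
      crossing ω n = blockCrossing (advance^[n] (stateAt (rho ω) 0)) ∧
        ∀ b, smallCrossing b ω n =
          truncCrossing (ENNReal.ofReal b) (advance^[n] (stateAt (rho ω) 0)) := by
  filter_upwards [ae_ladderLaw_ladder_zero hr, ae_ladderLaw_firstDescent_pos hr,
    cond_absolutelyContinuous.ae_le (ae_envLaw_pos hr),
    cond_absolutelyContinuous.ae_le (ae_envLaw_perpetuity_past_ne_top hr)]
    with ω h_zero h_pos hω hW n
  have hn := h_pos n
  rw [advance_iterate_stateAt h_zero h_pos] at hn ⊢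
  exact ⟨crossing_eq_blockCrossing hω hW hn, smallCrossing_eq_truncCrossing hω hW hn⟩

lemma meanCrossing_eq_blockMean : meanCrossing μ = blockMean (μ.map odds) := by
  rw [meanCrossing, blockMean,
    ← (measurePreserving_stateAt_rho hr).lintegral_comp measurable_blockCrossing]
  refine lintegral_congr_ae ?_
  filter_upwards [ae_ladderLaw_crossing_eq hr] with ω hω using (hω 0).1

end LadderLaw

section Subcritical

variable {s : ℝ}

lemma ofReal_mul_add_one_lt_rpow_add (hs : 1 < s) {a : ℝ≥0∞} (ha_one : a ≠ 1) (ha_top : a ≠ ∞) :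
    ENNReal.ofReal s * a + 1 < a ^ s + ENNReal.ofReal s := by
  lift a to ℝ≥0 using ha_top
  have h_sub : (a : ℝ) - 1 ≠ 0 := sub_ne_zero.2 (by exact_mod_cast ha_one)
  have h_bernoulli := one_add_mul_self_lt_rpow_one_add (by linarith [a.coe_nonneg]) h_sub hs
  rw [add_sub_cancel] at h_bernoulli
  rw [← ENNReal.ofReal_coe_nnreal, ENNReal.ofReal_rpow_of_nonneg a.coe_nonneg (by positivity),
    ← ENNReal.ofReal_mul (by positivity), ← ENNReal.ofReal_one,
    ← ENNReal.ofReal_add (by positivity) (by positivity),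
    ← ENNReal.ofReal_add (by positivity) (by positivity),
    ENNReal.ofReal_lt_ofReal_iff (by positivity)]
  linarith

lemma lintegral_lt_one_of_lintegral_rpow_le_one {Ω : Type*} [MeasurableSpace Ω] {P : Measure Ω}
    [IsProbabilityMeasure P] {X : Ω → ℝ≥0∞} (hX : AEMeasurable X P) (hs : 1 < s)
    (h_rpow : ∫⁻ ω, X ω ^ s ∂P ≤ 1) (h_ne : ∃ᵐ ω ∂P, X ω ≠ 1) : ∫⁻ ω, X ω ∂P < 1 := by
  have h_finite : ∀ᵐ ω ∂P, X ω ≠ ∞ := by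
    filter_upwards [ae_lt_top' (hX.pow_const s) (h_rpow.trans_lt ENNReal.one_lt_top).ne]
      with ω hω h_top
    rw [h_top, ENNReal.top_rpow_of_pos (by positivity)] at hω
    exact hω.ne rfl
  have h_le : ∀ᵐ ω ∂P, ENNReal.ofReal s * X ω + 1 ≤ X ω ^ s + ENNReal.ofReal s := by
    filter_upwards [h_finite] with ω h_top
    rcases eq_or_ne (X ω) 1 with h_one | h_one
    · simp [h_one, add_comm]
    · exact (ofReal_mul_add_one_lt_rpow_add hs h_one h_top).le
  have h_right : ∫⁻ ω, (X ω ^ s + ENNReal.ofReal s) ∂P ≤ 1 + ENNReal.ofReal s := by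
    rw [lintegral_add_right _ measurable_const, lintegral_const, measure_univ, mul_one]
    gcongr
  have h_lt := (lintegral_strict_mono_of_ae_le_of_frequently_ae_lt (by fun_prop)
    (ne_top_of_le_ne_top (by finiteness) ((lintegral_mono_ae h_le).trans h_right)) h_le
    ((h_ne.and_eventually h_finite).mono fun ω h =>
      (ofReal_mul_add_one_lt_rpow_add hs h.1 h.2).ne)).trans_le h_right
  rw [lintegral_add_right _ measurable_const, lintegral_const, measure_univ, mul_one, add_comm,
    lintegral_const_mul'' _ hX] at h_lt
  by_contra! h_one
  refine h_lt.not_ge ?_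
  gcongr
  exact le_mul_of_one_le_right' h_one

lemma lintegral_odds_lt_one {μ : Measure (Set.Icc (0 : ℝ) 1)} [IsProbabilityMeasure μ]
    (h : BallisticAssumption μ s) : ∫⁻ p, odds p ∂μ < 1 := by
  obtain ⟨hs, h_log, h_rpow⟩ := h
  refine lintegral_lt_one_of_lintegral_rpow_le_one (by fun_prop) hs h_rpow.le fun h_one => ?_
  refine h_log.ne (lintegral_congr_ae ?_)
  filter_upwards [h_one] with p hp
  rw [not_not.1 hp, ENNReal.log_one, neg_zero]

end Subcritical

lemma sum_coe_sub_coe {m : ℝ≥0∞} (hm : m ≠ ∞) (f : ℕ → ℝ≥0∞) (N : ℕ) :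
    ∑ i ∈ Finset.range N, ((f i : EReal) - m) =
      ((∑ i ∈ Finset.range N, f i : ℝ≥0∞) : EReal) - ((N * m.toReal : ℝ) : EReal) := by
  induction N with
  | zero => simp
  | succ N ih =>
    rw [Finset.sum_range_succ, ih, Finset.sum_range_succ, ← EReal.coe_ennreal_toReal hm,
      ← EReal.add_sub_add_comm (.inl (EReal.coe_ne_bot _)) (.inl (EReal.coe_ne_top _)),
      EReal.coe_ennreal_add, ← EReal.coe_add]
    congr 2
    push_cast
    ring

lemma smallCrossing_mono {b b' : ℝ} (hb : b ≤ b') (ω : Env) (i : ℤ) :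
    smallCrossing b ω i ≤ smallCrossing b' ω i :=
  Set.indicator_le_indicator_of_subset
    (fun _ hω => hω.trans (ENNReal.ofReal_le_ofReal hb)) (fun _ => bot_le) ω

lemma mul_le_sum_of_lt_sum_sub {m : ℝ≥0∞} (hm : m ≠ ∞) {f : ℕ → ℝ≥0∞} {N : ℕ} {κ : ℝ≥0} {t : ℝ}
    (hκ : N * κ ≤ N * m.toReal + t)
    (h : (t : EReal) < ∑ i ∈ Finset.range N, ((f i : EReal) - m)) :
    N * κ ≤ ∑ i ∈ Finset.range N, f i := by
  rw [sum_coe_sub_coe hm, EReal.lt_sub_iff_add_lt (.inl (EReal.coe_ne_bot _))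
    (.inl (EReal.coe_ne_top _)), ← EReal.coe_add] at h
  rw [← EReal.coe_ennreal_le_coe_ennreal_iff]
  calc ((N * κ : ℝ≥0∞) : EReal) = ((N * κ : ℝ) : EReal) := by push_cast; rfl
    _ ≤ ((t + N * m.toReal : ℝ) : EReal) := EReal.coe_le_coe_iff.2 (by linarith)
    _ ≤ _ := h.le

section LargeDeviations

variable {μ : Measure (Set.Icc (0 : ℝ) 1)} [IsProbabilityMeasure μ] (hr : ∫⁻ p, odds p ∂μ < 1)
include hr

lemma meanCrossing_ne_top : meanCrossing μ ≠ ∞ := by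
  rw [meanCrossing_eq_blockMean hr]
  exact blockMean_ne_top (by rwa [lintegral_map_odds])

lemma ladderLaw_lt_sum_sub_le {κ : ℝ≥0} {b t : ℝ} {N : ℕ}
    (hκ : N * κ ≤ N * (meanCrossing μ).toReal + t) :
    ladderLaw μ {ω | (t : EReal) <
        ∑ i ∈ Finset.range N, ((smallCrossing b ω (i : ℤ) : EReal) - (meanCrossing μ : EReal))} ≤
      stateLaw (μ.map odds) {z | N * κ ≤
        ∑ i ∈ Finset.range N, truncCrossing (ENNReal.ofReal b) (advance^[i] z)} := by
  have h_meas : MeasurableSet {z | N * κ ≤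
      ∑ i ∈ Finset.range N, truncCrossing (ENNReal.ofReal b) (advance^[i] z)} :=
    measurableSet_le measurable_const (Finset.measurable_sum _ fun i _ =>
      (measurable_truncCrossing _).comp (measurable_advance.iterate i))
  rw [← (measurePreserving_stateAt_rho hr).measure_preimage h_meas.nullMeasurableSet]
  refine measure_mono_ae ?_
  filter_upwards [ae_ladderLaw_crossing_eq hr] with ω hω h_lt
  refine (mul_le_sum_of_lt_sum_sub (meanCrossing_ne_top hr) hκ h_lt).trans_eq ?_
  exact Finset.sum_congr rfl fun i _ => (hω i).2 b

lemma exists_ladderLaw_lt_sum_sub_le {ε : ℝ} (hε : 0 < ε) :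
    ∃ θ : ℝ≥0, 0 < θ ∧ ∃ A : ℝ≥0∞, A ≠ ∞ ∧ ∀ b : ℝ≥0, 1 ≤ b → ∀ h N : ℕ, 0 < h → N ≠ 0 →
      ladderLaw μ {ω | ((ε * N : ℝ) : EReal) <
          ∑ i ∈ Finset.range N, ((smallCrossing b ω (i : ℤ) : EReal) - (meanCrossing μ : EReal))} ≤
        A * (N * (∫⁻ p, odds p ∂μ) ^ h + (eexp ↑(θ / (h * h * b) * N))⁻¹) := by
  have hκ : blockMean (μ.map odds) < ((meanCrossing μ).toNNReal + ε.toNNReal : ℝ≥0) := by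
    rw [← meanCrossing_eq_blockMean hr, ENNReal.coe_add,
      ENNReal.coe_toNNReal (meanCrossing_ne_top hr)]
    exact ENNReal.lt_add_right (meanCrossing_ne_top hr) (by simpa using hε)
  obtain ⟨θ, hθ, A, hA, h_bound⟩ := exists_stateLaw_le_sum_truncCrossing_le
    (by rwa [lintegral_map_odds]) hκ
  refine ⟨θ, hθ, A, hA, fun b hb h N hh hN => ?_⟩
  rw [lintegral_map_odds] at h_bound
  refine (ladderLaw_lt_sum_sub_le hr ?_).trans
    (by simpa only [ENNReal.ofReal_coe_nnreal] using h_bound b hb h N hh hN)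
  rw [NNReal.coe_add, Real.coe_toNNReal _ hε.le, ENNReal.coe_toNNReal_eq_toReal]
  linarith

end LargeDeviations

section Truncation

lemma exists_log_sq_add_two_pow_three_le {β : ℝ} (hβ : 0 < β) :
    ∃ D : ℝ, 0 < D ∧ ∀ y : ℝ, 1 ≤ y → (Real.log y ^ 2 + 2) ^ 3 ≤ D * y ^ β := by
  refine ⟨(36 / β ^ 2 + 2) ^ 3, by positivity, fun y hy => ?_⟩
  have h_log : Real.log y ^ 2 ≤ 36 / β ^ 2 * y ^ (β / 3) :=
    calc Real.log y ^ 2 ≤ (y ^ (β / 6) / (β / 6)) ^ 2 := by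
          gcongr
          · exact Real.log_nonneg hy
          · exact Real.log_le_rpow_div (by positivity) (by positivity)
      _ = 36 / β ^ 2 * y ^ (β / 3) := by
          rw [show β / 3 = β / 6 * (2 : ℕ) by push_cast; ring,
            Real.rpow_mul_natCast (by positivity)]
          field_simp
          norm_num
  have h_one : 1 ≤ y ^ (β / 3) := Real.one_le_rpow hy (by positivity)
  calc (Real.log y ^ 2 + 2) ^ 3 ≤ ((36 / β ^ 2 + 2) * y ^ (β / 3)) ^ 3 := by
        gcongr
        linarith
    _ = (36 / β ^ 2 + 2) ^ 3 * y ^ β := by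
        rw [mul_pow, ← Real.rpow_mul_natCast (by positivity)]
        congr 2
        push_cast
        ring

lemma exists_pow_le_exp_neg {r : ℝ≥0∞} (hr : r < 1) :
    ∃ c : ℝ, 0 < c ∧ ∀ h : ℕ, r ^ h ≤ ENNReal.ofReal (Real.exp (-c * h)) := by
  obtain ⟨q, hq, hrq, hq_one⟩ := ENNReal.lt_iff_exists_real_btwn.1 hr
  have hq_pos : 0 < q := ENNReal.ofReal_pos.1 (bot_le.trans_lt hrq)
  refine ⟨-Real.log q, neg_pos.2 (Real.log_neg hq_pos (by simpa using hq_one)), fun h => ?_⟩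
  rw [neg_neg, mul_comm, Real.exp_nat_mul, Real.exp_log hq_pos, ENNReal.ofReal_pow hq]
  gcongr

lemma exists_exponent_le {r : ℝ≥0∞} (hr : r < 1) {θ η₁ η₂ : ℝ} (hθ : 0 < θ) (hη : η₂ < η₁) :
    ∃ C : ℝ, 0 < C ∧ ∀ y : ℝ, 1 ≤ y → ∃ h : ℕ, 0 < h ∧
      r ^ h ≤ ENNReal.ofReal (Real.exp (-C * Real.log y ^ 2)) ∧
      C * Real.log y ^ 2 ≤ θ / (h * h * y ^ η₂) * ⌈y ^ η₁⌉₊ := by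
  obtain ⟨c, hc, h_pow⟩ := exists_pow_le_exp_neg hr
  obtain ⟨D, hD, h_log⟩ := exists_log_sq_add_two_pow_three_le (sub_pos.2 hη)
  refine ⟨min c (θ / D), by positivity, fun y hy => ?_⟩
  set L := Real.log y ^ 2
  have hL : 0 ≤ L := sq_nonneg _
  set h := ⌈L⌉₊ + 1 with h_def
  have hLh : L ≤ h := (Nat.le_ceil L).trans (by simp [h_def])
  have hhL : h ≤ L + 2 := by
    have := Nat.ceil_lt_add_one hL
    push_cast [h_def]
    linarith
  refine ⟨h, by positivity, (h_pow h).trans ?_, ?_⟩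
  · rw [neg_mul, neg_mul]
    gcongr
    exact min_le_left _ _
  · have h_ne : (h : ℝ) ≠ 0 := by positivity
    have h_cube : L * (h * h) ≤ D * y ^ (η₁ - η₂) :=
      calc L * (h * h) ≤ (L + 2) * ((L + 2) * (L + 2)) := by gcongr; linarith
        _ = (L + 2) ^ 3 := by ring
        _ ≤ D * y ^ (η₁ - η₂) := h_log y hy
    calc min c (θ / D) * L ≤ θ / D * L := by gcongr; exact min_le_right _ _
      _ = θ / (h * h * y ^ η₂) * (L * (h * h) / D * y ^ η₂) := by field_simp
      _ ≤ θ / (h * h * y ^ η₂) * (y ^ (η₁ - η₂) * y ^ η₂) := by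
        gcongr
        exact (div_le_iff₀' hD).2 h_cube
      _ = θ / (h * h * y ^ η₂) * y ^ η₁ := by rw [← Real.rpow_add (by positivity), sub_add_cancel]
      _ ≤ θ / (h * h * y ^ η₂) * ⌈y ^ η₁⌉₊ := by gcongr; exact Nat.le_ceil _

lemma inv_eexp_le {x : ℝ≥0} {t : ℝ} (h : t ≤ x) : (eexp x)⁻¹ ≤ ENNReal.ofReal (Real.exp (-t)) := by
  rw [eexp_coe, ← ENNReal.ofReal_inv_of_pos (Real.exp_pos _), ← Real.exp_neg]
  gcongr

lemma ladderLaw_lt_sum_sub_mono (μ : Measure (Set.Icc (0 : ℝ) 1)) {b b' t t' : ℝ} (hb : b ≤ b')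
    (ht : t' ≤ t) (N : ℕ) :
    ladderLaw μ {ω | (t : EReal) < ∑ i ∈ Finset.range N,
        ((smallCrossing b ω (i : ℤ) : EReal) - (meanCrossing μ : EReal))} ≤
      ladderLaw μ {ω | (t' : EReal) < ∑ i ∈ Finset.range N,
        ((smallCrossing b' ω (i : ℤ) : EReal) - (meanCrossing μ : EReal))} :=
  measure_mono fun ω hω => (EReal.coe_le_coe_iff.2 ht).trans_lt <| hω.trans_le <|
    Finset.sum_le_sum fun i _ => EReal.sub_le_sub
      (EReal.coe_ennreal_le_coe_ennreal_iff.2 (smallCrossing_mono hb ω i)) le_rfl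

theorem exists_ladderLaw_lt_sum_sub_le_exp
    {μ : Measure (Set.Icc (0 : ℝ) 1)} [IsProbabilityMeasure μ]
    (hr : ∫⁻ p, odds p ∂μ < 1) {η₁ η₂ ε : ℝ} (hη₁ : 0 < η₁) (hη : η₂ < η₁) (hε : 0 < ε) :
    ∃ C C' : ℝ, 0 < C ∧ 0 < C' ∧ ∀ n : ℕ, 1 ≤ n →
      ladderLaw μ {ω | ((ε * (n : ℝ) ^ η₁ : ℝ) : EReal) < ∑ i ∈ Finset.range ⌈(n : ℝ) ^ η₁⌉₊,
        ((smallCrossing ((n : ℝ) ^ η₂) ω (i : ℤ) : EReal) - (meanCrossing μ : EReal))} ≤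
        ENNReal.ofReal (C' * (n : ℝ) ^ η₁ * Real.exp (-C * Real.log (n : ℝ) ^ 2)) := by
  obtain ⟨θ, hθ, A, hA, h_bound⟩ := exists_ladderLaw_lt_sum_sub_le hr (half_pos hε)
  obtain ⟨C, hC, h_exponent⟩ := exists_exponent_le hr hθ (max_lt hη hη₁)
  refine ⟨C, 3 * A.toReal + 1, hC, by positivity, fun n hn => ?_⟩
  have hn' : (1 : ℝ) ≤ n := by exact_mod_cast hn
  obtain ⟨h, hh, h_pow, h_exp⟩ := h_exponent n hn'
  set a := (n : ℝ) ^ η₁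
  set b : ℝ≥0 := (n : ℝ≥0) ^ max η₂ 0
  set E := Real.exp (-C * Real.log n ^ 2) with hE
  have ha : 1 ≤ a := Real.one_le_rpow hn' hη₁.le
  have hN : (⌈a⌉₊ : ℝ) < a + 1 := Nat.ceil_lt_add_one (by positivity)
  calc _ ≤ _ := ladderLaw_lt_sum_sub_mono μ (b' := b) (t' := ε / 2 * ⌈a⌉₊)
        (by push_cast [b]; gcongr; exact le_max_left _ _) (by nlinarith) ⌈a⌉₊
    _ ≤ A * (⌈a⌉₊ * (∫⁻ p, odds p ∂μ) ^ h + (eexp ↑(θ / (h * h * b) * ⌈a⌉₊))⁻¹) :=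
        h_bound b (NNReal.one_le_rpow (by exact_mod_cast hn) (le_max_right _ _)) h _ hh
          (by positivity)
    _ ≤ A * (⌈a⌉₊ * ENNReal.ofReal E + ENNReal.ofReal E) := by
        gcongr
        rw [hE, neg_mul]
        exact inv_eexp_le (by push_cast [b]; exact h_exp)
    _ = ENNReal.ofReal (A.toReal * (⌈a⌉₊ * E + E)) := by
        rw [ENNReal.ofReal_mul ENNReal.toReal_nonneg, ENNReal.ofReal_toReal hA,
          ENNReal.ofReal_add (by positivity) (by positivity), ENNReal.ofReal_mul (by positivity),
          ENNReal.ofReal_natCast]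
    _ ≤ ENNReal.ofReal ((3 * A.toReal + 1) * a * E) := by
        refine ENNReal.ofReal_le_ofReal ?_
        have : (⌈a⌉₊ + 1) * (A.toReal * E) ≤ 3 * a * (A.toReal * E) := by gcongr; linarith
        nlinarith [show 0 ≤ a * E by positivity]

end Truncation

end RWRE

end

theorem mainTheorem3_general
    (μ : MeasureTheory.Measure (Set.Icc (0 : ℝ) 1)) [MeasureTheory.IsProbabilityMeasure μ]
    (hr : ∫⁻ p, RWRE.odds p ∂μ < 1) (η₁ η₂ : ℝ) (hη₁ : 0 < η₁) (hη : η₂ < η₁) :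
    RWRE.envLaw μ {ω | RWRE.ladder ω 0 = 0} ≠ 0 ∧
    RWRE.meanCrossing μ ≠ ∞ ∧
    ∀ ε : ℝ, 0 < ε → ∃ C C' : ℝ, 0 < C ∧ 0 < C' ∧ ∀ n : ℕ, 1 ≤ n →
      RWRE.ladderLaw μ {ω |
          ((ε * (n : ℝ) ^ η₁ : ℝ) : EReal) <
            ∑ i ∈ Finset.range ⌈(n : ℝ) ^ η₁⌉₊,
              ((RWRE.smallCrossing ((n : ℝ) ^ η₂) ω (i : ℤ) : EReal) -
                (RWRE.meanCrossing μ : EReal))} ≤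
        ENNReal.ofReal (C' * (n : ℝ) ^ η₁ * Real.exp (-C * Real.log (n : ℝ) ^ 2)) :=
  ⟨RWRE.envLaw_ladder_zero_ne_zero hr, RWRE.meanCrossing_ne_top hr,
    fun _ hε => RWRE.exists_ladderLaw_lt_sum_sub_le_exp hr hη₁ hη hε⟩

theorem mainTheorem3
    (μ : MeasureTheory.Measure (Set.Icc (0 : ℝ) 1)) [MeasureTheory.IsProbabilityMeasure μ] (s : ℝ)
    (hball : RWRE.BallisticAssumption μ s) (hreg : RWRE.RegularityAssumption μ s)
    (η₁ η₂ : ℝ) (hη₂ : 0 < η₂) (hη : η₂ < η₁) :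
    RWRE.envLaw μ {ω | RWRE.ladder ω 0 = 0} ≠ 0 ∧
    RWRE.meanCrossing μ ≠ ∞ ∧
    ∀ ε : ℝ, 0 < ε → ∃ C C' : ℝ, 0 < C ∧ 0 < C' ∧ ∀ n : ℕ, 1 ≤ n →
      RWRE.ladderLaw μ {ω |
          ((ε * (n : ℝ) ^ η₁ : ℝ) : EReal) <
            ∑ i ∈ Finset.range ⌈(n : ℝ) ^ η₁⌉₊,
              ((RWRE.smallCrossing ((n : ℝ) ^ η₂) ω (i : ℤ) : EReal) -
                (RWRE.meanCrossing μ : EReal))} ≤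
        ENNReal.ofReal (C' * (n : ℝ) ^ η₁ * Real.exp (-C * Real.log (n : ℝ) ^ 2)) :=
  mainTheorem3_general μ (RWRE.lintegral_odds_lt_one hball) η₁ η₂ (hη₂.trans hη) hη
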